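/- Let $n\ge 1$. For a family $\mathcal S$ of $n$ pairwise disjoint line segments in the plane, an alternating path among $\mathcal S$ is a simple polygonal chain in which every other segment is in $\mathcal S$; it is compatible with $\mathcal S$ if it does not cross any segment of $\mathcal S$ that is not in the chain. Let $p(n)$ (respectively, $q(n)$) be the maximum number $k$ such that every family $\mathcal S$ of $n$ pairwise disjoint line segments in the plane whose $2n$ endpoints are in convex position (no endpoint lies in the convex hull of the others) admits an alternating path among $\mathcal S$ (respectively, an alternating path among $\mathcal S$ that is compatible with $\mathcal S$) going through exactly $k$ segments of $\mathcal S$. A caterpillar is a tree whose non-leaf vertices induce a (possibly empty) path. Then for every $m\ge 1$ these maxima exist, and $p(m)$ (respectively, $q(m)$) equals the maximum number $k$ such that every tree with $m$ edges can be transformed into a caterpillar with exactly $k$ edges by contracting edges (respectively, by removing vertices). -/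

import Mathlib

namespace AltPath

/-- The Euclidean plane. -/
abbrev Plane : Type := EuclideanSpace ℝ (Fin 2)

/-! ### Families of disjoint segments and alternating paths -/

/-- A family of `n` pairwise disjoint (closed, nondegenerate) line segments in the plane. -/
structure SegmentFamily (n : ℕ) where
  /-- one endpoint of each segment -/
  left : Fin n → Plane
  /-- the other endpoint of each segment -/
  right : Fin n → Plane
  left_ne_right : ∀ i, left i ≠ right i
  disjoint : ∀ i j, i ≠ j →
    Disjoint (segment ℝ (left i) (right i)) (segment ℝ (left j) (right j))

/-- The `2n` endpoints are in convex position: none of them is in the convex hull of the others. -/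
def SegmentFamily.InConvexPosition {n : ℕ} (S : SegmentFamily n) : Prop :=
  ConvexIndependent ℝ (Sum.elim S.left S.right : Fin n ⊕ Fin n → Plane)

/-- A polygonal chain with `length` segments, given by its sequence of vertices. -/
structure PolygonalChain where
  length : ℕ
  vertex : Fin (length + 1) → Plane

/-- The `i`-th segment of a polygonal chain, as a set of points. -/
def PolygonalChain.edge (c : PolygonalChain) (i : Fin c.length) : Set Plane :=
  segment ℝ (c.vertex i.castSucc) (c.vertex i.succ)

/-- A simple chain: its segments are nondegenerate, two consecutive segments meet only in their
common vertex, and two segments that are not consecutive are disjoint. -/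
def PolygonalChain.IsSimple (c : PolygonalChain) : Prop :=
  (∀ i : Fin c.length, c.vertex i.castSucc ≠ c.vertex i.succ) ∧
  (∀ i j : Fin c.length, (i : ℕ) + 1 = j → c.edge i ∩ c.edge j = {c.vertex i.succ}) ∧
  (∀ i j : Fin c.length, (i : ℕ) + 1 < j → Disjoint (c.edge i) (c.edge j))

/-- The `i`-th segment of the chain is the `j`-th segment of the family (in either direction). -/
def PolygonalChain.EdgeIs (c : PolygonalChain) {n : ℕ} (S : SegmentFamily n)
    (i : Fin c.length) (j : Fin n) : Prop :=
  s(c.vertex i.castSucc, c.vertex i.succ) = s(S.left j, S.right j)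

/-- The chain goes through the `j`-th segment of the family. -/
def PolygonalChain.GoesThrough (c : PolygonalChain) {n : ℕ} (S : SegmentFamily n)
    (j : Fin n) : Prop :=
  ∃ i, c.EdgeIs S i j

/-- An alternating path among `S`: a simple polygonal chain in which every other segment
is in `S`. -/
def IsAlternatingPath {n : ℕ} (S : SegmentFamily n) (c : PolygonalChain) : Prop :=
  c.IsSimple ∧ ∃ e : ℕ, ∀ i : Fin c.length, (∃ j, c.EdgeIs S i j) ↔ Even ((i : ℕ) + e)

/-- The chain is compatible with `S`: it does not cross any segment of `S` that is not in the
chain. -/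
def IsCompatible {n : ℕ} (S : SegmentFamily n) (c : PolygonalChain) : Prop :=
  ∀ j, ¬ c.GoesThrough S j →
    ∀ i, Disjoint (c.edge i) (segment ℝ (S.left j) (S.right j))

/-- The number of segments of `S` that the chain goes through. -/
noncomputable def throughCount {n : ℕ} (S : SegmentFamily n) (c : PolygonalChain) : ℕ :=
  {j | c.GoesThrough S j}.ncard

/-- The numbers `k` such that every family of `n` disjoint segments with endpoints in convex
position admits an alternating path going through `k` of its segments. -/
def pathSizes (n : ℕ) : Set ℕ :=
  {k | ∀ S : SegmentFamily n, S.InConvexPosition →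
    ∃ c, IsAlternatingPath S c ∧ throughCount S c = k}

/-- The numbers `k` such that every family `S` of `n` disjoint segments with endpoints in convex
position admits an alternating path compatible with `S` going through `k` of its segments. -/
def compatiblePathSizes (n : ℕ) : Set ℕ :=
  {k | ∀ S : SegmentFamily n, S.InConvexPosition →
    ∃ c, IsAlternatingPath S c ∧ IsCompatible S c ∧ throughCount S c = k}

/-- `p(n)`: the maximum of `pathSizes n`. -/
noncomputable def p (n : ℕ) : ℕ := sSup (pathSizes n)

/-- `q(n)`: the maximum of `compatiblePathSizes n`. -/
noncomputable def q (n : ℕ) : ℕ := sSup (compatiblePathSizes n)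

/-! ### Trees and caterpillars -/

/-- A caterpillar: a tree whose non-leaf vertices induce a path (possibly the empty one, so that
a single edge is a caterpillar). -/
def IsCaterpillar {V : Type} (G : SimpleGraph V) : Prop :=
  G.IsTree ∧
    ∃ l : ℕ, Nonempty (G.induce {v | (G.neighborSet v).ncard ≠ 1} ≃g SimpleGraph.pathGraph l)

/-- The graph `G / F` obtained from `G` by contracting the edges in `F`: its vertices are the
connected components of the graph `(V, F)`, and two different ones are adjacent if and only if
some edge of `G` joins them. -/
def contractEdges {V : Type} (G : SimpleGraph V) (F : Set (Sym2 V)) :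
    SimpleGraph (SimpleGraph.fromEdgeSet F).ConnectedComponent where
  Adj X Y := X ≠ Y ∧ ∃ u v, G.Adj u v ∧
    (SimpleGraph.fromEdgeSet F).connectedComponentMk u = X ∧
    (SimpleGraph.fromEdgeSet F).connectedComponentMk v = Y
  symm := ⟨fun _ _ ⟨h, u, v, huv, hu, hv⟩ => ⟨h.symm, v, u, huv.symm, hv, hu⟩⟩
  loopless := ⟨fun _ h => h.1 rfl⟩

/-- The numbers `k` such that every tree with `m` edges can be transformed into a caterpillar with
`k` edges by contracting edges. -/
def contractionSizes (m : ℕ) : Set ℕ :=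
  {k | ∀ (V : Type) [Finite V] (T : SimpleGraph V), T.IsTree → T.edgeSet.ncard = m →
    ∃ F ⊆ T.edgeSet, IsCaterpillar (contractEdges T F) ∧ (contractEdges T F).edgeSet.ncard = k}

/-- The numbers `k` such that every tree with `m` edges can be transformed into a caterpillar with
`k` edges by removing vertices (`A` is the set of vertices that remain). -/
def removalSizes (m : ℕ) : Set ℕ :=
  {k | ∀ (V : Type) [Finite V] (T : SimpleGraph V), T.IsTree → T.edgeSet.ncard = m →
    ∃ A : Set V, IsCaterpillar (T.induce A) ∧ (T.induce A).edgeSet.ncard = k}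

end AltPath

/-! A segment of a family in convex position splits the other segments into two sides, and an edge
of a tree splits the other edges into two sides. Only these splits matter; a relation `B` records
them, up to exchanging the two sides of any element (the `congr` lemmas). Both problems ask for the
same thing: `k` elements in an order such that each has all earlier ones on one side and all later
ones on one side, possibly the same. In the compatible problem and the removal problem, moreover, no
omitted element may separate two chosen ones. So not only the maxima but the whole sets of sizes
coincide.

Paths. The parts of a simple chain before and after one of its segments do not cross that segment,
so the segments of an alternating path, in the order of traversal, are arranged
(`IsAlternatingPath.exists_arrangement`). Conversely, number the endpoints counterclockwise from an
end of the first segment, so that segments become nested or separate intervals and the first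
contains all others. Then none contains an earlier one. Take the interval that starts first and the
one that ends last: if they coincide, it contains all others, and otherwise the earlier of the two
in the arrangement contains none. Either way that segment can be traversed from its outer end, and
the path goes on through the rest (`IsNoncrossing.exists_unobstructed`). The order of the path need
not be the given one.

Trees. The edges of a caterpillar are arranged along its spine, pendant edges being inserted at
their spine vertex (`exists_noSeparation`). Conversely, in an arrangement of all edges of a tree,
those at a given vertex are consecutive, which makes the non-leaves a path
(`isCaterpillar_of_ordered`). Contraction preserves the cuts of the surviving edges; a set of edges
spans a subtree when no other edge separates two of them.

Comparison. Rooting the tree, or choosing where the numbering starts, turns the splits into a forest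
order: lying beyond an edge, or inside an interval. Every finite forest order arises from a rooted
tree (`exists_tree`) and from chords of a parabola (`exists_segmentFamily`). Hence quantifying over
trees or over families is quantifying over forest orders. -/

namespace AltPath

/-! ### Arrangements without separation -/

/-- Read `B j i` as "`j` lies on the marked side of `i`". In the arrangement `f`, no element
separates two earlier ones or two later ones. -/
def NoSeparation {E : Type} (B : E → E → Prop) {k : ℕ} (f : Fin k → E) : Prop :=
  ∀ i j j', (j < i ∧ j' < i) ∨ (i < j ∧ i < j') → (B (f j) (f i) ↔ B (f j') (f i))

/-- Some `k` elements can be arranged without separation. -/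
def Arrangeable {E : Type} (B : E → E → Prop) (k : ℕ) : Prop :=
  ∃ f : Fin k → E, Function.Injective f ∧ NoSeparation B f

/-- Some `k` elements which no other element separates can be arranged without separation. -/
def ConnectedArrangeable {E : Type} (B : E → E → Prop) (k : ℕ) : Prop :=
  ∃ f : Fin k → E, Function.Injective f ∧ NoSeparation B f ∧
    ∀ e ∉ Set.range f, ∀ j j', B (f j) e ↔ B (f j') e

/-- Separation only compares two elements relative to a third one, so the values `B e e` and the
choice of the marked sides are irrelevant. -/
theorem NoSeparation.congr {E E' : Type} {B : E → E → Prop} {B' : E' → E' → Prop} {k : ℕ}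
    {f : Fin k → E} {f' : Fin k → E'}
    (h : ∀ i j j', j ≠ i → j' ≠ i →
      (B (f j) (f i) ↔ B (f j') (f i)) → (B' (f' j) (f' i) ↔ B' (f' j') (f' i)))
    (hf : NoSeparation B f) : NoSeparation B' f' := by
  intro i j j' hj
  refine h i j j' ?_ ?_ (hf i j j' hj)
  · rcases hj with h | h
    · exact h.1.ne
    · exact h.1.ne'
  · rcases hj with h | h
    · exact h.2.ne
    · exact h.2.ne'

theorem Arrangeable.congr {E : Type} {B B' : E → E → Prop} {k : ℕ}
    (h : ∀ e f g, f ≠ e → g ≠ e → (B f e ↔ B g e) → (B' f e ↔ B' g e))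
    (hB : Arrangeable B k) : Arrangeable B' k := by
  obtain ⟨f, hf, hn⟩ := hB
  exact ⟨f, hf, hn.congr fun i j j' hj hj' => h _ _ _ (hf.ne hj) (hf.ne hj')⟩

theorem ConnectedArrangeable.congr {E : Type} {B B' : E → E → Prop} {k : ℕ}
    (h : ∀ e f g, f ≠ e → g ≠ e → (B f e ↔ B g e) → (B' f e ↔ B' g e))
    (hB : ConnectedArrangeable B k) : ConnectedArrangeable B' k := by
  obtain ⟨f, hf, hn, ho⟩ := hB
  refine ⟨f, hf, hn.congr fun i j j' hj hj' => h _ _ _ (hf.ne hj) (hf.ne hj'),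
    fun e he j j' => h _ _ _ ?_ ?_ (ho e he j j')⟩
  · rintro rfl; exact he ⟨j, rfl⟩
  · rintro rfl; exact he ⟨j', rfl⟩

/-! ### Cut systems -/

/-- The edges of `G` are the pairs `s(a i, b i)`, and the cut `D i` separates the ends of the
edge `i` and of no other edge. -/
structure IsCutSystem {V E : Type} (G : SimpleGraph V) (a b : E → V) (D : E → V → Prop) :
    Prop where
  adj_iff : ∀ x y, G.Adj x y ↔ ∃ i, s(a i, b i) = s(x, y)
  cut : ∀ i j, (D i (a j) ↔ D i (b j)) ↔ i ≠ j

namespace IsCutSystem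

variable {V E : Type} {G : SimpleGraph V} {a b : E → V} {D : E → V → Prop}

theorem edge_inj (hc : IsCutSystem G a b D) {i j : E} (h : s(a i, b i) = s(a j, b j)) :
    i = j := by
  by_contra hij
  have h1 := (hc.cut i j).2 hij
  have h2 := hc.cut i i
  rcases Sym2.eq_iff.1 h with ⟨h3, h4⟩ | ⟨h3, h4⟩ <;> rw [h3, h4] at h2 <;> tauto

theorem edgeSet_eq (hc : IsCutSystem G a b D) : G.edgeSet = Set.range fun i => s(a i, b i) := by
  ext e
  induction e with
  | _ x y => simpa using hc.adj_iff x y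

theorem ncard_edgeSet (hc : IsCutSystem G a b D) : G.edgeSet.ncard = Nat.card E := by
  rw [hc.edgeSet_eq, ← Set.image_univ, Set.ncard_image_of_injective _ fun i j h => hc.edge_inj h,
    Set.ncard_univ]

theorem adj_cut (hc : IsCutSystem G a b D) (i : E) {x y : V} (h : G.Adj x y) :
    (D i x ↔ D i y) ↔ s(a i, b i) ≠ s(x, y) := by
  obtain ⟨j, hj⟩ := (hc.adj_iff x y).1 h
  have h1 := hc.cut i j
  have h2 : s(a i, b i) = s(x, y) ↔ i = j :=
    ⟨fun h => hc.edge_inj (h.trans hj.symm), fun h => h ▸ hj⟩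
  rw [Ne, h2, ← Ne, ← h1]
  rcases Sym2.eq_iff.1 hj with ⟨h3, h4⟩ | ⟨h3, h4⟩ <;> rw [h3, h4]
  exact iff_comm

/-- A vertex of the edge `j ≠ i` is on the same side of the cut `i` as `a j`. -/
theorem side_iff (hc : IsCutSystem G a b D) {i j : E} (hij : i ≠ j) {x : V}
    (hx : x ∈ s(a j, b j)) : D i (a j) ↔ D i x := by
  rcases Sym2.mem_iff.1 hx with rfl | rfl
  · rfl
  · exact (hc.cut i j).2 hij

/-- The edge `i` has an end on each side of its cut. -/
theorem exists_mem_side (hc : IsCutSystem G a b D) (i : E) (P : Prop) :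
    ∃ x ∈ s(a i, b i), (D i x ↔ P) := by
  have := hc.cut i i
  by_cases h : D i (a i) ↔ P
  · exact ⟨_, Sym2.mem_mk_left _ _, h⟩
  · exact ⟨_, Sym2.mem_mk_right _ _, by tauto⟩

theorem walk_side (hc : IsCutSystem G a b D) {i : E} {x y : V} (p : G.Walk x y)
    (hp : s(a i, b i) ∉ p.edges) : D i x ↔ D i y := by
  induction p with
  | nil => rfl
  | cons h p ih =>
    rw [SimpleGraph.Walk.edges_cons, List.mem_cons, not_or] at hp
    exact ((hc.adj_cut i h).2 hp.1).trans (ih hp.2)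

theorem path_side (hc : IsCutSystem G a b D) {i : E} {x y : V} (p : G.Walk x y) (hp : p.IsPath)
    (hi : s(a i, b i) ∈ p.edges) : ¬ (D i x ↔ D i y) := by
  induction p with
  | nil => simp at hi
  | @cons u v w h p ih =>
    have hnd := hp.isTrail.edges_nodup
    rw [SimpleGraph.Walk.edges_cons] at hi hnd
    rw [List.nodup_cons] at hnd
    have h1 := hc.adj_cut i h
    rcases List.mem_cons.1 hi with h2 | h2
    · have h3 := hc.walk_side (i := i) p (h2 ▸ hnd.1)
      tauto
    · have h3 := ih hp.of_cons h2
      have h4 : s(a i, b i) ≠ s(u, v) := fun h => hnd.1 (h ▸ h2)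
      tauto

/-- The cut of any edge on a path separates the ends of the path. Vertices can therefore be
identified by comparing them on all cuts. -/
theorem eq_of_sides (hc : IsCutSystem G a b D) (hG : G.Connected) {x y : V}
    (h : ∀ i, D i x ↔ D i y) : x = y := by
  obtain ⟨p, hp⟩ := (hG.preconnected x y).exists_isPath
  cases p with
  | nil => rfl
  | cons hxy p =>
    obtain ⟨i, hi⟩ := (hc.adj_iff _ _).1 hxy
    exact absurd (h i) (hc.path_side _ hp (by simp [hi]))

/-- Every edge is a bridge, since a walk avoiding it stays on one side of its cut. -/
theorem isTree (hc : IsCutSystem G a b D) (hG : G.Connected) : G.IsTree := by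
  refine ⟨hG, SimpleGraph.isAcyclic_iff_forall_adj_isBridge.2 fun x y hxy => ?_⟩
  rw [SimpleGraph.isBridge_iff]
  rintro ⟨p⟩
  obtain ⟨i, hi⟩ := (hc.adj_iff _ _).1 hxy
  have h1 := hc.walk_side (i := i) (p.mapLe (SimpleGraph.deleteEdges_le _)) (by
    rw [SimpleGraph.Walk.edges_mapLe_eq_edges]
    intro h
    have := p.edges_subset_edgeSet h
    rw [SimpleGraph.edgeSet_deleteEdges] at this
    exact this.2 hi)
  exact (hc.adj_cut i hxy).1 h1 hi

theorem comp (hc : IsCutSystem G a b D) {E' : Type} {f : E' → E} (hf : Function.Bijective f) :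
    IsCutSystem G (a ∘ f) (b ∘ f) (D ∘ f) where
  adj_iff x y := by
    rw [hc.adj_iff]
    constructor
    · rintro ⟨i, hi⟩
      obtain ⟨j, rfl⟩ := hf.2 i
      exact ⟨j, hi⟩
    · rintro ⟨j, hj⟩
      exact ⟨f j, hj⟩
  cut i j := (hc.cut (f i) (f j)).trans hf.1.ne_iff

/-- Replacing each cut by its complement where needed, a given vertex lies in none of them. -/
theorem exists_root (hc : IsCutSystem G a b D) (r : V) :
    ∃ D' : E → V → Prop, IsCutSystem G a b D' ∧ ∀ i, ¬ D' i r := by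
  refine ⟨fun i x => ¬ (D i x ↔ D i r), ⟨hc.adj_iff, fun i j => ?_⟩, fun i => by simp⟩
  rw [← hc.cut i j]
  tauto

end IsCutSystem

/-- Deleting an edge of a tree leaves two components, and these are the sides of its cut;
complementing puts the root `r` outside every marked side. -/
theorem exists_isCutSystem {V : Type} [Finite V] {T : SimpleGraph V} (hT : T.IsTree) {m : ℕ}
    (hm : T.edgeSet.ncard = m) (r : V) :
    ∃ (a b : Fin m → V) (D : Fin m → V → Prop), IsCutSystem T a b D ∧ ∀ i, ¬ D i r := by
  classical
  have hE : Nat.card T.edgeSet = m := hm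
  let e : Fin m ≃ T.edgeSet := (Finite.equivFinOfCardEq hE).symm
  have h1 : ∀ i, ∃ a b, s(a, b) = (e i : Sym2 V) := fun i => by
    induction h : (e i : Sym2 V) with
    | _ x y => exact ⟨x, y, rfl⟩
  choose a b hab using h1
  have hadj : ∀ i, T.Adj (a i) (b i) := fun i => by
    rw [← SimpleGraph.mem_edgeSet, hab]
    exact (e i).2
  have hc : IsCutSystem T a b fun i x => (T.deleteEdges {s(a i, b i)}).Reachable (a i) x := by
    constructor
    · intro x y
      constructor
      · intro h
        obtain ⟨i, hi⟩ := e.surjective ⟨s(x, y), h⟩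
        exact ⟨i, by rw [hab, hi]⟩
      · rintro ⟨i, hi⟩
        rw [← SimpleGraph.mem_edgeSet, ← hi, hab]
        exact (e i).2
    · intro i j
      constructor
      · rintro h rfl
        have h2 := SimpleGraph.isAcyclic_iff_forall_adj_isBridge.1 hT.isAcyclic (hadj i)
        rw [SimpleGraph.isBridge_iff] at h2
        exact h2 (h.1 .rfl)
      · intro hij
        have h3 : (T.deleteEdges {s(a i, b i)}).Adj (a j) (b j) := by
          rw [SimpleGraph.deleteEdges_adj]
          refine ⟨hadj j, fun h => hij ?_⟩
          rw [Set.mem_singleton_iff, hab, hab] at h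
          exact (e.injective (Subtype.ext h)).symm
        exact ⟨fun h => h.trans h3.reachable, fun h => h.trans h3.symm.reachable⟩
  obtain ⟨D, hD, hr⟩ := hc.exists_root r
  exact ⟨a, b, D, hD, hr⟩

/-! ### Caterpillars -/

theorem pathGraph_iso_of_linearOrder {N : Type} [Finite N] [LinearOrder N] {H : SimpleGraph N}
    (h : ∀ v w, v < w → (H.Adj v w ↔ v ⋖ w)) :
    ∃ l : ℕ, Nonempty (H ≃g SimpleGraph.pathGraph l) := by
  have := Fintype.ofFinite N
  refine ⟨Fintype.card N, ⟨(⟨(Fintype.orderIsoFinOfCardEq N rfl).symm.toEquiv, ?_⟩ :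
    H ≃g SimpleGraph.pathGraph _)⟩⟩
  intro v w
  rw [SimpleGraph.pathGraph, SimpleGraph.hasse_adj]
  have h1 := apply_covBy_apply_iff (Fintype.orderIsoFinOfCardEq N rfl).symm (a := v) (b := w)
  have h2 := apply_covBy_apply_iff (Fintype.orderIsoFinOfCardEq N rfl).symm (a := w) (b := v)
  change (_ ⋖ _ ∨ _ ⋖ _) ↔ _
  refine (or_congr h1 h2).trans ?_
  rcases lt_trichotomy v w with hvw | rfl | hvw
  · rw [h v w hvw]
    exact or_iff_left fun h => h.lt.not_gt hvw
  · exact ⟨fun h => h.elim (fun h => absurd h.lt (lt_irrefl _)) fun h => absurd h.lt (lt_irrefl _),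
      fun h => absurd rfl h.ne⟩
  · rw [H.adj_comm, h w v hvw]
    exact or_iff_right fun h => h.lt.not_gt hvw

/-- A graph whose vertices carry sets of at least two consecutive numbers that overlap in at most
one number, adjacency being overlap, and that cover without gaps, is a path. -/
theorem pathGraph_iso_of_intervals {N : Type} [Finite N] {H : SimpleGraph N} (s : N → Set ℕ)
    (two : ∀ v, ∃ n ∈ s v, ∃ n' ∈ s v, n < n')
    (conv : ∀ v, ∀ n ∈ s v, ∀ n' ∈ s v, ∀ j, n < j → j < n' → j ∈ s v)
    (overlap : ∀ v w n n', n ∈ s v → n ∈ s w → n' ∈ s v → n' ∈ s w → n ≠ n' → v = w)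
    (cover : ∀ v w, ∀ n ∈ s v, ∀ n' ∈ s w, n < n' → ∃ u, n ∈ s u ∧ n + 1 ∈ s u)
    (adj : ∀ v w, H.Adj v w ↔ v ≠ w ∧ ∃ n, n ∈ s v ∧ n ∈ s w) :
    ∃ l : ℕ, Nonempty (H ≃g SimpleGraph.pathGraph l) := by
  have hmem : ∀ v, sInf (s v) ∈ s v := fun v => Nat.sInf_mem (let ⟨n, hn, _⟩ := two v; ⟨n, hn⟩)
  have hle : ∀ v, ∀ n ∈ s v, sInf (s v) ≤ n := fun v n hn => Nat.sInf_le hn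
  have hconv : ∀ v, ∀ n ∈ s v, ∀ j, sInf (s v) ≤ j → j ≤ n → j ∈ s v := by
    intro v n hn j h1 h2
    rcases h1.eq_or_lt with h | h1
    · exact h ▸ hmem v
    rcases h2.eq_or_lt with h | h2
    · exact h ▸ hn
    exact conv v _ (hmem v) n hn j h1 h2
  have hsucc : ∀ v, sInf (s v) + 1 ∈ s v := by
    intro v
    obtain ⟨n, hn, n', hn', h⟩ := two v
    exact hconv v n' hn' _ (Nat.le_succ _) (by have := hle v n hn; omega)
  have hinj : Function.Injective fun v => sInf (s v) := by
    intro v w h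
    have h : sInf (s v) = sInf (s w) := h
    exact overlap v w _ _ (hmem v) (h ▸ hmem w) (hsucc v) (h ▸ hsucc w) (by omega)
  -- The vertices are ordered by the left ends of their intervals, which are distinct because each
  -- interval also contains the next number.
  let : LinearOrder N := LinearOrder.lift' _ hinj
  have hlt : ∀ v w : N, v < w ↔ sInf (s v) < sInf (s w) := fun _ _ => Iff.rfl
  have key : ∀ v w : N, v < w → ∀ n ∈ s v, n ≤ sInf (s w) := by
    intro v w hvw n hn
    rw [hlt] at hvw
    by_contra! hcon
    have := overlap v w _ _ (hconv v n hn (sInf (s w)) hvw.le hcon.le) (hmem w)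
      (hconv v n hn (sInf (s w) + 1) (by omega) hcon) (hsucc w) (by omega)
    subst this
    omega
  refine pathGraph_iso_of_linearOrder fun v w hvw => ?_
  rw [adj]
  constructor
  · rintro ⟨-, n, hnv, hnw⟩
    have h1 := key v w hvw n hnv
    obtain rfl : n = sInf (s w) := le_antisymm h1 (hle w n hnw)
    refine ⟨hvw, fun u hvu huw => ?_⟩
    rw [hlt] at hvu huw
    have := overlap v u _ _ (hconv v _ hnv (sInf (s u)) hvu.le huw.le) (hmem u)
      (hconv v _ hnv (sInf (s u) + 1) (by omega) huw) (hsucc u) (by omega)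
    subst this
    omega
  · intro hcov
    refine ⟨hvw.ne, sInf (s w), ?_, hmem w⟩
    by_contra hcon
    -- If the interval of `v` ended at `β` before that of `w` begins, the vertex covering `β` and `β
    -- + 1` would begin exactly at `β` and lie strictly between `v` and `w`.
    obtain ⟨β, hβ, hmax⟩ : ∃ β ∈ s v, ∀ n ∈ s v, n ≤ β := by
      have hb : BddAbove (s v) := ⟨_, fun n hn => key v w hvw n hn⟩
      exact ⟨sSup (s v), Nat.sSup_mem ⟨_, hmem v⟩ hb, fun n hn => le_csSup hb hn⟩
    have h1 : β < sInf (s w) := lt_of_le_of_ne (key v w hvw β hβ) fun h => hcon (h ▸ hβ)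
    have h2 := hmax _ (hsucc v)
    obtain ⟨u, hu, hu'⟩ := cover v w β hβ _ (hmem w) h1
    have hne : v ≠ u := by
      rintro rfl
      have := hmax _ hu'
      omega
    have h3 : sInf (s u) = β := by
      by_contra h4
      have h5 := hle u β hu
      exact hne (overlap v u (β - 1) β (hconv v β hβ _ (by omega) (by omega))
        (hconv u β hu _ (by omega) (by omega)) hβ hu (by omega))
    exact hcov.2 ((hlt v u).2 (by omega)) ((hlt u w).2 (by omega))

/-! ### Arranged edges form a caterpillar -/

namespace IsCutSystem

variable {V : Type} {G : SimpleGraph V}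

section Ordered

variable {k : ℕ} {a b : Fin k → V} {D : Fin k → V → Prop}

theorem agree (hc : IsCutSystem G a b D) (hv : NoSeparation (fun j i => D i (a j)) id)
    {i j j' : Fin k} (h : (j < i ∧ j' < i) ∨ (i < j ∧ i < j')) {x x' : V}
    (hx : x ∈ s(a j, b j)) (hx' : x' ∈ s(a j', b j')) : D i x ↔ D i x' := by
  have h1 : i ≠ j := by rintro rfl; rcases h with h | h <;> exact lt_irrefl _ h.1
  have h2 : i ≠ j' := by rintro rfl; rcases h with h | h <;> exact lt_irrefl _ h.2
  rw [← hc.side_iff h1 hx, ← hc.side_iff h2 hx']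
  exact hv i j j' h

/-- The end of `j` on the side of `v` agrees with `v` on every cut: for a cut before `j`, view `v`
as an end of the later edge `l`; for a cut after `j`, as an end of the earlier edge `i`. -/
theorem mem_of_between (hc : IsCutSystem G a b D) (hG : G.Connected)
    (hv : NoSeparation (fun j i => D i (a j)) id) {i j l : Fin k} (hij : i < j) (hjl : j < l)
    {v : V} (hi : v ∈ s(a i, b i)) (hl : v ∈ s(a l, b l)) : v ∈ s(a j, b j) := by
  obtain ⟨x, hx, hxv⟩ := hc.exists_mem_side j (D j v)
  suffices x = v by rwa [← this]
  refine hc.eq_of_sides hG fun t => ?_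
  rcases lt_trichotomy t j with h | rfl | h
  · exact hc.agree hv (.inr ⟨h, h.trans hjl⟩) hx hl
  · exact hxv
  · exact hc.agree hv (.inl ⟨h, hij.trans h⟩) hx hi

/-- The facing ends of two consecutive edges agree on their own two cuts by choice, and on every
other cut because no edge comes between the two. -/
theorem exists_common (hc : IsCutSystem G a b D) (hG : G.Connected)
    (hv : NoSeparation (fun j i => D i (a j)) id) {i j : Fin k} (hij : (i : ℕ) + 1 = j) :
    ∃ x, x ∈ s(a i, b i) ∧ x ∈ s(a j, b j) := by
  have hne : i ≠ j := by rintro rfl; omega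
  obtain ⟨x, hx, hxi⟩ := hc.exists_mem_side i (D i (a j))
  obtain ⟨y, hy, hyj⟩ := hc.exists_mem_side j (D j x)
  suffices x = y from ⟨x, hx, this ▸ hy⟩
  refine hc.eq_of_sides hG fun t => ?_
  rcases lt_trichotomy t i with h | rfl | h
  · exact hc.agree hv (.inr ⟨h, h.trans (Fin.lt_def.2 (by omega))⟩) hx hy
  · exact hxi.trans (hc.side_iff hne hy)
  · rcases eq_or_ne t j with rfl | h'
    · exact hyj.symm
    · have h2 : j < t := by
        rw [Fin.lt_def] at h ⊢
        have := Fin.val_ne_of_ne h'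
        omega
      exact hc.agree hv (.inl ⟨h, h2⟩) hx hy

/-- The numbers of the edges at a vertex form an interval. Non-leaves have at least two of them,
distinct vertices share at most one edge, and consecutive edges meet, so
`pathGraph_iso_of_intervals` applies. -/
theorem isCaterpillar_of_ordered [Finite V] (hc : IsCutSystem G a b D) (hG : G.Connected)
    (hv : NoSeparation (fun j i => D i (a j)) id) : IsCaterpillar G := by
  refine ⟨hc.isTree hG, ?_⟩
  have hne : ∀ i, a i ≠ b i := fun i h => by
    have := hc.cut i i
    rw [h] at this
    tauto
  rcases Nat.eq_zero_or_pos k with rfl | hk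
  -- Without edges the tree is a single vertex, which counts as a non-leaf since its degree is `0`.
  · have hsub : ∀ x y : V, x = y := fun x y => hc.eq_of_sides hG fun i => i.elim0
    let : LinearOrder {v | (G.neighborSet v).ncard ≠ 1} :=
      LinearOrder.lift' (fun _ => (0 : ℕ)) fun x y _ => Subtype.ext (hsub _ _)
    exact pathGraph_iso_of_linearOrder fun v w h => absurd (Subtype.ext (hsub _ _)) h.ne
  have hinc : ∀ v w, G.Adj v w → ∃ i, v ∈ s(a i, b i) ∧ s(a i, b i) = s(v, w) := by
    intro v w h
    obtain ⟨i, hi⟩ := (hc.adj_iff v w).1 h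
    exact ⟨i, hi ▸ Sym2.mem_mk_left _ _, hi⟩
  have hnb : ∀ v i, v ∈ s(a i, b i) → ∃ w, G.Adj v w ∧ s(a i, b i) = s(v, w) := by
    intro v i h
    obtain ⟨w, hw⟩ := Sym2.mem_iff_exists.1 h
    exact ⟨w, (hc.adj_iff v w).2 ⟨i, hw⟩, hw⟩
  have hedge : ∀ v w i j, v ≠ w → v ∈ s(a i, b i) → w ∈ s(a i, b i) → v ∈ s(a j, b j) →
      w ∈ s(a j, b j) → i = j := by
    intro v w i j hvw h1 h2 h3 h4
    exact hc.edge_inj (((Sym2.mem_and_mem_iff hvw).1 ⟨h1, h2⟩).trans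
      ((Sym2.mem_and_mem_iff hvw).1 ⟨h3, h4⟩).symm)
  let s : {v | (G.neighborSet v).ncard ≠ 1} → Set ℕ :=
    fun v => {n | ∃ h : n < k, (v : V) ∈ s(a ⟨n, h⟩, b ⟨n, h⟩)}
  refine pathGraph_iso_of_intervals s ?_ ?_ ?_ ?_ ?_
  · rintro ⟨v, hv1⟩
    have : Nontrivial V := ⟨_, _, hne ⟨0, hk⟩⟩
    obtain ⟨w, hw⟩ := hG.preconnected.exists_adj_of_nontrivial v
    obtain ⟨w', hw', hww'⟩ : ∃ w', G.Adj v w' ∧ w' ≠ w := by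
      by_contra! hcon
      refine hv1 (Set.ncard_eq_one.2 ⟨w, Set.eq_singleton_iff_unique_mem.2 ⟨hw, hcon⟩⟩)
    obtain ⟨i, hi, hi'⟩ := hinc _ _ hw
    obtain ⟨j, hj, hj'⟩ := hinc _ _ hw'
    have hij : (i : ℕ) ≠ j := by
      intro h
      obtain rfl := Fin.ext h
      exact hww' (Sym2.congr_right.1 (hj'.symm.trans hi'))
    rcases lt_or_gt_of_ne hij with h | h
    · exact ⟨i, ⟨i.2, hi⟩, j, ⟨j.2, hj⟩, h⟩
    · exact ⟨j, ⟨j.2, hj⟩, i, ⟨i.2, hi⟩, h⟩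
  · rintro v n ⟨hn, hvn⟩ n' ⟨hn', hvn'⟩ j h1 h2
    exact ⟨h2.trans hn', hc.mem_of_between hG hv (Fin.lt_def.2 h1) (Fin.lt_def.2 h2) hvn hvn'⟩
  · rintro v w n n' ⟨hn, h1⟩ ⟨_, h2⟩ ⟨hn', h3⟩ ⟨_, h4⟩ hnn
    by_contra hvw
    exact hnn (congrArg Fin.val (hedge _ _ _ _ (fun h => hvw (Subtype.ext h)) h1 h2 h3 h4))
  · rintro v w n ⟨hn, h1⟩ n' ⟨hn', h2⟩ hnn
    obtain ⟨x, hx, hx'⟩ := hc.exists_common hG hv (i := ⟨n, hn⟩) (j := ⟨n + 1, by omega⟩) rfl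
    refine ⟨⟨x, fun h => ?_⟩, ⟨hn, hx⟩, ⟨by omega, hx'⟩⟩
    obtain ⟨y, hy⟩ := Set.ncard_eq_one.1 h
    obtain ⟨z, hz, hz'⟩ := hnb _ _ hx
    obtain ⟨w, hw, hw'⟩ := hnb _ _ hx'
    rw [← SimpleGraph.mem_neighborSet, hy] at hz hw
    obtain rfl := hz
    obtain rfl := hw
    have := congrArg Fin.val (hc.edge_inj (hz'.trans hw'.symm))
    simp at this
  · rintro ⟨v, hv1⟩ ⟨w, hw1⟩
    rw [SimpleGraph.comap_adj]
    constructor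
    · intro h
      obtain ⟨i, hi, hi'⟩ := hinc _ _ h
      exact ⟨fun h' => h.ne (congrArg Subtype.val h'), i, ⟨i.2, hi⟩,
        ⟨i.2, by rw [Fin.eta, hi']; exact Sym2.mem_mk_right _ _⟩⟩
    · rintro ⟨h, n, ⟨hn, h1⟩, _, h2⟩
      exact (hc.adj_iff v w).2 ⟨⟨n, hn⟩, (Sym2.mem_and_mem_iff
        (fun h' => h (Subtype.ext h'))).1 ⟨h1, h2⟩⟩

end Ordered

theorem isCaterpillar_of_noSeparation [Finite V] {E : Type} {a b : E → V} {D : E → V → Prop}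
    (hc : IsCutSystem G a b D) (hG : G.Connected) {k : ℕ} {f : Fin k → E}
    (hf : Function.Bijective f) (hv : NoSeparation (fun j i => D i (a j)) f) :
    IsCaterpillar G :=
  (hc.comp hf).isCaterpillar_of_ordered hG hv

end IsCutSystem
-- The edges of a caterpillar can be arranged
namespace IsCutSystem

variable {V E : Type} {G : SimpleGraph V} {a b : E → V} {D : E → V → Prop}

/-- The cut of an edge with a leaf `u` separates `u` from all other vertices. -/
theorem side_of_leaf (hc : IsCutSystem G a b D) (hG : G.Connected) {i : E} {u v : V}
    (hi : s(a i, b i) = s(u, v)) (hu : (G.neighborSet u).ncard = 1) {x y : V}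
    (hx : x ≠ u) (hy : y ≠ u) : D i x ↔ D i y := by
  classical
  obtain ⟨w, hw⟩ := Set.ncard_eq_one.1 hu
  have huv : G.Adj u v := (hc.adj_iff u v).2 ⟨i, hi⟩
  have hv : ∀ z, G.Adj u z → z = v := by
    intro z hz
    have h1 : z ∈ G.neighborSet u := hz
    have h2 : v ∈ G.neighborSet u := huv
    rw [hw] at h1 h2
    exact h1.trans h2.symm
  -- Folding the leaf `u` onto its neighbour `v` turns any walk into one that avoids the edge `uv`.
  let ρ : V → V := fun z => if z = u then v else z
  have key : ∀ {z z' : V} (_ : G.Walk z z'), D i (ρ z) ↔ D i (ρ z') := by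
    intro z z' p
    induction p with
    | nil => rfl
    | @cons z t z' h p ih =>
      refine Iff.trans ?_ ih
      by_cases hz : z = u
      · subst hz
        obtain rfl := hv t h
        simp [ρ]
      · by_cases ht : t = u
        · subst ht
          obtain rfl := hv z h.symm
          simp [ρ]
        · simp only [ρ, if_neg hz, if_neg ht]
          refine (hc.adj_cut i h).2 fun h' => ?_
          have : u ∈ s(z, t) := by rw [← h', hi]; exact Sym2.mem_mk_left _ _
          rcases Sym2.mem_iff.1 this with h | h
          · exact hz h.symm
          · exact ht h.symm
  obtain ⟨p⟩ := hG.preconnected x y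
  simpa [ρ, hx, hy] using key p

theorem ends_side (hc : IsCutSystem G a b D) {i : E} {u v : V} (hi : s(a i, b i) = s(u, v)) :
    ¬ (D i u ↔ D i v) := fun h =>
  (hc.adj_cut i ((hc.adj_iff u v).2 ⟨i, hi⟩)).1 h hi

/-- An edge both of whose ends are leaves is the only edge. -/
theorem eq_of_leaves (hc : IsCutSystem G a b D) (hG : G.Connected) {i : E} {u v : V}
    (hi : s(a i, b i) = s(u, v)) (hu : (G.neighborSet u).ncard = 1)
    (hv : (G.neighborSet v).ncard = 1) (j : E) : j = i := by
  have huv := hc.ends_side hi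
  have hne : u ≠ v := by rintro rfl; exact huv .rfl
  have hall : ∀ z, z = u ∨ z = v := by
    intro z
    by_contra! h
    have h1 := hc.side_of_leaf hG hi hu h.1 hne.symm
    have h2 := hc.side_of_leaf hG (hi.trans Sym2.eq_swap) hv h.2 hne
    exact huv (h2.symm.trans h1)
  have hj := hc.ends_side (i := j) rfl
  have hab : a j ≠ b j := fun h => hj (h ▸ Iff.rfl)
  refine hc.edge_inj (Eq.trans ?_ hi.symm)
  rcases hall (a j) with h1 | h1 <;> rcases hall (b j) with h2 | h2 <;>
    first | exact absurd (h1.trans h2.symm) hab | simp [h1, h2, Sym2.eq_swap]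

/-- With `ψ` the position on the spine, a pendant edge at the spine vertex `v` gets the key `2 * ψ
v` and a spine edge from `u` to the next vertex gets `2 * ψ u + 1`. Sorting by key works: the cut of
a pendant edge separates no two other edges, and the cut of a spine edge separates smaller keys from
larger ones. -/
theorem exists_noSeparation [Finite V] [Finite E] (hc : IsCutSystem G a b D)
    (h : IsCaterpillar G) {k : ℕ} (hk : Nat.card E = k) :
    ∃ f : Fin k → E, Function.Bijective f ∧ NoSeparation (fun j i => D i (a j)) f := by
  classical
  have hG := h.1.connected
  obtain ⟨l, ⟨φ⟩⟩ := h.2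
  let N : Set V := {v | (G.neighborSet v).ncard ≠ 1}
  obtain ⟨ψ, hψ⟩ : ∃ ψ : V → ℕ, ∀ x : N, ψ x = φ x :=
    ⟨fun v => if h : v ∈ N then φ ⟨v, h⟩ else 0, fun x => by simp⟩
  have hleaf : ∀ x, x ∉ N → (G.neighborSet x).ncard = 1 := fun x hx => not_not.1 hx
  have hadj : ∀ x ∈ N, ∀ y ∈ N, G.Adj x y ↔ ψ x + 1 = ψ y ∨ ψ y + 1 = ψ x := by
    intro x hx y hy
    rw [hψ ⟨x, hx⟩, hψ ⟨y, hy⟩, ← SimpleGraph.pathGraph_adj, φ.map_adj_iff,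
      SimpleGraph.comap_adj]
    rfl
  have hinj : ∀ x ∈ N, ∀ y ∈ N, ψ x = ψ y → x = y := by
    intro x hx y hy hxy
    rw [hψ ⟨x, hx⟩, hψ ⟨y, hy⟩] at hxy
    exact congrArg Subtype.val (φ.injective (Fin.ext hxy))
  have hsurj : ∀ x ∈ N, ∀ n < ψ x, ∃ y ∈ N, ψ y = n := by
    intro x hx n hn
    rw [hψ ⟨x, hx⟩] at hn
    let y := φ.symm ⟨n, hn.trans (φ ⟨x, hx⟩).2⟩
    exact ⟨y, y.2, by rw [hψ y]; simp [y]⟩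
  have hcases : ∀ i, (∃ u v, s(a i, b i) = s(u, v) ∧ u ∉ N) ∨
      ∃ u ∈ N, ∃ v ∈ N, s(a i, b i) = s(u, v) ∧ ψ u + 1 = ψ v := by
    intro i
    by_cases h1 : a i ∈ N
    · by_cases h2 : b i ∈ N
      · right
        rcases (hadj _ h1 _ h2).1 ((hc.adj_iff _ _).2 ⟨i, rfl⟩) with h3 | h3
        · exact ⟨_, h1, _, h2, rfl, h3⟩
        · exact ⟨_, h2, _, h1, Sym2.eq_swap, h3⟩
      · exact .inl ⟨_, _, Sym2.eq_swap, h2⟩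
    · exact .inl ⟨_, _, rfl, h1⟩
  have hkey : ∀ i, ∃ κ : ℕ, (∀ u v, s(a i, b i) = s(u, v) → u ∉ N → v ∈ N → κ = 2 * ψ v) ∧
      ∀ u v, s(a i, b i) = s(u, v) → u ∈ N → v ∈ N → ψ u + 1 = ψ v → κ = 2 * ψ u + 1 := by
    intro i
    rcases hcases i with ⟨u, v, huv, hu⟩ | ⟨u, hu, v, hv, huv, h⟩
    -- If `v` is a leaf too, `ψ v` is the default `0`, but then both requirements on the key are
    -- vacuous.
    · refine ⟨2 * ψ v, fun u' v' h' hu' hv' => ?_, fun u' v' h' hu' hv' _ => ?_⟩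
      · rcases Sym2.eq_iff.1 (huv.symm.trans h') with ⟨rfl, rfl⟩ | ⟨rfl, rfl⟩
        · rfl
        · exact absurd hv' hu
      · rcases Sym2.eq_iff.1 (huv.symm.trans h') with ⟨rfl, rfl⟩ | ⟨rfl, rfl⟩
        · exact absurd hu' hu
        · exact absurd hv' hu
    · refine ⟨2 * ψ u + 1, fun u' v' h' hu' hv' => ?_, fun u' v' h' hu' hv' h'' => ?_⟩
      · rcases Sym2.eq_iff.1 (huv.symm.trans h') with ⟨rfl, rfl⟩ | ⟨rfl, rfl⟩
        · exact absurd hu hu'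
        · exact absurd hv hu'
      · rcases Sym2.eq_iff.1 (huv.symm.trans h') with ⟨rfl, rfl⟩ | ⟨rfl, rfl⟩
        · rfl
        · omega
  choose κ hκ1 hκ2 using hkey
  let e : Fin k ≃ E := (Finite.equivFinOfCardEq hk).symm
  let σ := Tuple.sort (κ ∘ e)
  have hmono : Monotone ((κ ∘ e) ∘ σ) := Tuple.monotone_sort _
  refine ⟨e ∘ σ, e.bijective.comp σ.bijective, fun i j j' hjj => ?_⟩
  have hne : e (σ j) ≠ e (σ i) ∧ e (σ j') ≠ e (σ i) := by
    rw [e.injective.ne_iff, e.injective.ne_iff, σ.injective.ne_iff, σ.injective.ne_iff]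
    rcases hjj with h | h
    · exact ⟨h.1.ne, h.2.ne⟩
    · exact ⟨h.1.ne', h.2.ne'⟩
  have hord : (κ (e (σ j)) ≤ κ (e (σ i)) ∧ κ (e (σ j')) ≤ κ (e (σ i))) ∨
      (κ (e (σ i)) ≤ κ (e (σ j)) ∧ κ (e (σ i)) ≤ κ (e (σ j'))) := by
    rcases hjj with h | h
    · exact .inl ⟨hmono h.1.le, hmono h.2.le⟩
    · exact .inr ⟨hmono h.1.le, hmono h.2.le⟩
  simp only [Function.comp_apply]
  generalize e (σ i) = i at *
  generalize e (σ j) = j at *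
  generalize e (σ j') = j' at *
  clear hjj
  rcases hcases i with ⟨u, v, huv, hu⟩ | ⟨u, hu, v, hv, huv, hψuv⟩
  -- For a pendant edge `i` with leaf `u`, both other edges have an end different from `u`, and the
  -- cut of `i` does not separate those ends.
  · obtain ⟨x, hx, hxu⟩ : ∃ x ∈ s(a j, b j), x ≠ u := by
      obtain ⟨x, hx, hxs⟩ := hc.exists_mem_side j (¬ D j u)
      exact ⟨x, hx, by rintro rfl; tauto⟩
    obtain ⟨x', hx', hxu'⟩ : ∃ x ∈ s(a j', b j'), x ≠ u := by
      obtain ⟨x, hx, hxs⟩ := hc.exists_mem_side j' (¬ D j' u)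
      exact ⟨x, hx, by rintro rfl; tauto⟩
    rw [hc.side_iff hne.1.symm hx, hc.side_iff hne.2.symm hx']
    exact hc.side_of_leaf hG huv (hleaf u hu) hxu hxu'
  have hκi : κ i = 2 * ψ u + 1 := hκ2 i u v huv hu hv hψuv
  have step : ∀ x ∈ N, ∀ y ∈ N, ψ x + 1 = ψ y → ψ x ≠ ψ u → (D i x ↔ D i y) := by
    intro x hx y hy hxy hxu
    refine (hc.adj_cut i ((hadj x hx y hy).2 (.inl hxy))).2 fun h => ?_
    rcases Sym2.eq_iff.1 (huv.symm.trans h) with ⟨rfl, rfl⟩ | ⟨rfl, rfl⟩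
    · exact hxu rfl
    · omega
  have up : ∀ n, ∀ w ∈ N, ψ w = ψ v + n → (D i w ↔ D i v) := by
    intro n
    induction n with
    | zero => intro w hw h; rw [hinj w hw v hv h]
    | succ n ih =>
      intro w hw h
      obtain ⟨y, hy, hyn⟩ := hsurj w hw (ψ v + n) (by omega)
      exact (step y hy w hw (by omega) (by omega)).symm.trans (ih y hy hyn)
  have down : ∀ n, ∀ w ∈ N, ψ w + n = ψ u → (D i w ↔ D i u) := by
    intro n
    induction n with
    | zero => intro w hw h; rw [hinj w hw u hu h]
    | succ n ih =>
      intro w hw h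
      obtain ⟨y, hy, hyn⟩ : ∃ y ∈ N, ψ y = ψ w + 1 := by
        rcases Nat.eq_zero_or_pos n with rfl | hn
        · exact ⟨u, hu, h.symm⟩
        · exact hsurj u hu (ψ w + 1) (by omega)
      refine (step w hw y hy (by omega) (by omega)).trans (ih y hy (by omega))
  -- Each edge is represented by one of its spine vertices, and walking along the spine from there
  -- to `v` or `u` does not use the edge `i`.
  have side : ∀ t, t ≠ i → (κ i ≤ κ t → (D i (a t) ↔ D i v)) ∧
      (κ t ≤ κ i → (D i (a t) ↔ D i u)) := by
    intro t ht
    rcases hcases t with ⟨x, y, hxy, hx⟩ | ⟨x, hx, y, hy, hxy, h⟩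
    · have hy : y ∈ N := fun h => ht (hc.eq_of_leaves hG hxy (hleaf x hx) h i).symm
      have hκt := hκ1 t x y hxy hx hy
      rw [hc.side_iff ht.symm (hxy ▸ Sym2.mem_mk_right x y)]
      exact ⟨fun h => up (ψ y - ψ v) y hy (by omega), fun h => down (ψ u - ψ y) y hy (by omega)⟩
    · have hκt := hκ2 t x y hxy hx hy h
      have hxu : ψ x ≠ ψ u := by
        intro h'
        obtain rfl := hinj x hx u hu h'
        obtain rfl := hinj y hy v hv (by omega)
        exact ht (hc.edge_inj (hxy.trans huv.symm))
      constructor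
      · intro h
        rw [hc.side_iff ht.symm (hxy ▸ Sym2.mem_mk_left x y)]
        exact up (ψ x - ψ v) x hx (by omega)
      · intro h
        rw [hc.side_iff ht.symm (hxy ▸ Sym2.mem_mk_right x y)]
        exact down (ψ u - ψ y) y hy (by omega)
  rcases hord with h | h
  · exact ((side j hne.1).2 h.1).trans ((side j' hne.2).2 h.2).symm
  · exact ((side j hne.1).1 h.1).trans ((side j' hne.2).1 h.2).symm

/-! ### Contracting edges and removing vertices -/

/-- The edges of the path from `x` to `y` have cuts separating `x` from `y`, so the path lies in `F`
as soon as no cut of an edge outside `F` does so. -/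
theorem mk_eq_iff (hc : IsCutSystem G a b D) (hG : G.Connected) {F : Set (Sym2 V)}
    (hF : F ⊆ G.edgeSet) (x y : V) :
    (SimpleGraph.fromEdgeSet F).connectedComponentMk x =
      (SimpleGraph.fromEdgeSet F).connectedComponentMk y ↔
    ∀ i, s(a i, b i) ∉ F → (D i x ↔ D i y) := by
  rw [SimpleGraph.ConnectedComponent.eq]
  constructor
  · rintro ⟨p⟩ i hi
    have hle : SimpleGraph.fromEdgeSet F ≤ G := by
      rw [SimpleGraph.fromEdgeSet_le]
      exact Set.sdiff_subset.trans hF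
    refine hc.walk_side (p.mapLe hle) fun h => hi ?_
    rw [SimpleGraph.Walk.edges_mapLe_eq_edges] at h
    have := p.edges_subset_edgeSet h
    rw [SimpleGraph.edgeSet_fromEdgeSet] at this
    exact this.1
  · intro h
    obtain ⟨p, hp⟩ := (hG.preconnected x y).exists_isPath
    refine ⟨p.transfer _ fun e he => ?_⟩
    have he' := p.edges_subset_edgeSet he
    obtain ⟨i, rfl⟩ : ∃ i, s(a i, b i) = e := by simpa [hc.edgeSet_eq] using he'
    rw [SimpleGraph.edgeSet_fromEdgeSet]
    refine ⟨?_, G.not_isDiag_of_mem_edgeSet he'⟩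
    by_contra hi
    exact hc.path_side p hp he (h i hi)

theorem contractEdges_side (hc : IsCutSystem G a b D) (hG : G.Connected) {F : Set (Sym2 V)}
    (hF : F ⊆ G.edgeSet) {i : E} (hi : s(a i, b i) ∉ F) (x : V) :
    (∃ y, (SimpleGraph.fromEdgeSet F).connectedComponentMk y =
      (SimpleGraph.fromEdgeSet F).connectedComponentMk x ∧ D i y) ↔ D i x := by
  constructor
  · rintro ⟨y, hy, h⟩
    exact ((hc.mk_eq_iff hG hF y x).1 hy i hi).1 h
  · exact fun h => ⟨x, rfl, h⟩

/-- The cut of an edge outside `F` is a union of components of `F`, so it descends to the quotient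
and still separates the ends of that edge only. -/
theorem contractEdges (hc : IsCutSystem G a b D) (hG : G.Connected) {F : Set (Sym2 V)}
    (hF : F ⊆ G.edgeSet) :
    IsCutSystem (contractEdges G F)
      (fun i : {i // s(a i, b i) ∉ F} => (SimpleGraph.fromEdgeSet F).connectedComponentMk (a i))
      (fun i => (SimpleGraph.fromEdgeSet F).connectedComponentMk (b i))
      (fun i X => ∃ x, (SimpleGraph.fromEdgeSet F).connectedComponentMk x = X ∧ D i x) := by
  constructor
  · intro X Y
    constructor
    · rintro ⟨hXY, u, v, huv, rfl, rfl⟩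
      obtain ⟨i, hi⟩ := (hc.adj_iff u v).1 huv
      refine ⟨⟨i, fun hiF => hXY ?_⟩, ?_⟩
      · refine (hc.mk_eq_iff hG hF u v).2 fun j hj => (hc.adj_cut j huv).2 fun h => hj ?_
        rwa [h, ← hi]
      · exact congrArg (Sym2.map (SimpleGraph.fromEdgeSet F).connectedComponentMk) hi
    · rintro ⟨i, hi⟩
      have hne : (SimpleGraph.fromEdgeSet F).connectedComponentMk (a i) ≠
          (SimpleGraph.fromEdgeSet F).connectedComponentMk (b i) := fun h =>
        (hc.cut i i).1 ((hc.mk_eq_iff hG hF _ _).1 h i i.2) rfl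
      have hadj : G.Adj (a i) (b i) := (hc.adj_iff _ _).2 ⟨i, rfl⟩
      rcases Sym2.eq_iff.1 hi with ⟨rfl, rfl⟩ | ⟨rfl, rfl⟩
      · exact ⟨hne, _, _, hadj, rfl, rfl⟩
      · exact ⟨hne.symm, _, _, hadj.symm, rfl, rfl⟩
  · intro i j
    rw [hc.contractEdges_side hG hF i.2, hc.contractEdges_side hG hF i.2, hc.cut, Ne, Ne,
      Subtype.ext_iff]

end IsCutSystem

theorem connected_contractEdges {V : Type} {G : SimpleGraph V} (hG : G.Connected)
    (F : Set (Sym2 V)) : (contractEdges G F).Connected := by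
  have := hG.nonempty
  refine ⟨fun X Y => ?_⟩
  induction X using SimpleGraph.ConnectedComponent.ind with | _ x
  induction Y using SimpleGraph.ConnectedComponent.ind with | _ y
  obtain ⟨p⟩ := hG.preconnected x y
  induction p with
  | nil => rfl
  | @cons u v w h p ih =>
    refine SimpleGraph.Reachable.trans ?_ ih
    by_cases he : (SimpleGraph.fromEdgeSet F).connectedComponentMk u =
        (SimpleGraph.fromEdgeSet F).connectedComponentMk v
    · rw [he]
    · exact SimpleGraph.Adj.reachable ⟨he, u, v, h, rfl, rfl⟩

theorem IsCutSystem.induce {V E : Type} {G : SimpleGraph V} {a b : E → V} {D : E → V → Prop}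
    (hc : IsCutSystem G a b D) (A : Set V) :
    IsCutSystem (G.induce A) (fun i : {i // a i ∈ A ∧ b i ∈ A} => ⟨a i, i.2.1⟩)
      (fun i => ⟨b i, i.2.2⟩) (fun i x => D i x) := by
  constructor
  · rintro ⟨x, hx⟩ ⟨y, hy⟩
    rw [SimpleGraph.comap_adj]
    refine (hc.adj_iff x y).trans ⟨?_, ?_⟩
    · rintro ⟨i, hi⟩
      rcases Sym2.eq_iff.1 hi with ⟨rfl, rfl⟩ | ⟨rfl, rfl⟩
      · exact ⟨⟨i, hx, hy⟩, rfl⟩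
      · exact ⟨⟨i, hy, hx⟩, Sym2.eq_swap⟩
    · rintro ⟨i, hi⟩
      exact ⟨i, congrArg (Sym2.map Subtype.val) hi⟩
  · intro i j
    exact (hc.cut i j).trans (not_congr (Subtype.ext_iff).symm)

namespace IsCutSystem

variable {V E : Type} {G : SimpleGraph V} {a b : E → V} {D : E → V → Prop}

/-- Contract exactly the edges that are not arranged; the surviving ones keep their sides. -/
theorem exists_contractEdges_iff [Finite V] [Finite E] (hc : IsCutSystem G a b D)
    (hG : G.Connected) (k : ℕ) :
    (∃ F ⊆ G.edgeSet, IsCaterpillar (AltPath.contractEdges G F) ∧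
      (AltPath.contractEdges G F).edgeSet.ncard = k) ↔ Arrangeable (fun j i => D i (a j)) k := by
  have hfin : ∀ F : Set (Sym2 V), Finite (SimpleGraph.fromEdgeSet F).ConnectedComponent :=
    fun F => Quot.finite _
  constructor
  · rintro ⟨F, hF, hcat, hk⟩
    have := hfin F
    have hc' := hc.contractEdges hG hF
    obtain ⟨f, hf, hn⟩ := hc'.exists_noSeparation hcat (hc'.ncard_edgeSet.symm.trans hk)
    refine ⟨fun i => f i, Subtype.val_injective.comp hf.1, hn.congr fun i j j' _ _ h => ?_⟩
    rwa [hc.contractEdges_side hG hF (f i).2, hc.contractEdges_side hG hF (f i).2] at h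
  · rintro ⟨f, hf, hn⟩
    let F : Set (Sym2 V) := {e ∈ G.edgeSet | ∀ i, s(a (f i), b (f i)) ≠ e}
    have hF : F ⊆ G.edgeSet := fun e he => he.1
    have := hfin F
    have hfF : ∀ i, s(a (f i), b (f i)) ∉ F := fun i h => h.2 i rfl
    let f' : Fin k → {i // s(a i, b i) ∉ F} := fun i => ⟨f i, hfF i⟩
    have hf' : Function.Bijective f' := by
      refine ⟨fun i j h => hf (congrArg Subtype.val h), ?_⟩
      rintro ⟨i, hi⟩
      obtain ⟨j, hj⟩ : ∃ j, s(a (f j), b (f j)) = s(a i, b i) := by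
        by_contra! h
        exact hi ⟨(hc.adj_iff _ _).2 ⟨i, rfl⟩, h⟩
      exact ⟨j, Subtype.ext (hc.edge_inj hj)⟩
    have hc' := hc.contractEdges hG hF
    refine ⟨F, hF, hc'.isCaterpillar_of_noSeparation (connected_contractEdges hG F) hf'
      (hn.congr fun i j j' _ _ h => ?_), ?_⟩
    · rwa [hc.contractEdges_side hG hF (f' i).2, hc.contractEdges_side hG hF (f' i).2]
    · rw [hc'.ncard_edgeSet, ← Nat.card_eq_of_bijective f' hf', Nat.card_fin]

/-- A walk inside `A` never uses an edge that leaves `A`, so a removed edge cannot separate kept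
ones. Conversely, if no omitted edge separates chosen ones, the paths between their ends use chosen
edges only. -/
theorem exists_induce_iff [Finite V] [Finite E] (hc : IsCutSystem G a b D)
    (hG : G.Connected) (k : ℕ) :
    (∃ A : Set V, IsCaterpillar (G.induce A) ∧ (G.induce A).edgeSet.ncard = k) ↔
      ConnectedArrangeable (fun j i => D i (a j)) k := by
  constructor
  · rintro ⟨A, hcat, hk⟩
    have hc' := hc.induce A
    obtain ⟨f, hf, hn⟩ := hc'.exists_noSeparation hcat (hc'.ncard_edgeSet.symm.trans hk)
    refine ⟨fun i => f i, Subtype.val_injective.comp hf.1, hn, fun e he j j' => ?_⟩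
    have heA : ¬ (a e ∈ A ∧ b e ∈ A) := fun h => he <| by
      obtain ⟨i, hi⟩ := hf.2 ⟨e, h⟩
      exact ⟨i, congrArg Subtype.val hi⟩
    obtain ⟨p⟩ := hcat.1.connected.preconnected ⟨_, (f j).2.1⟩ ⟨_, (f j').2.1⟩
    have key : ∀ {x y : A} (_ : (G.induce A).Walk x y), D e x ↔ D e y := by
      intro x y p
      induction p with
      | nil => rfl
      | @cons x y z h p ih =>
        refine ((hc.adj_cut e h).2 fun h' => heA ?_).trans ih
        rcases Sym2.eq_iff.1 h' with ⟨h1, h2⟩ | ⟨h1, h2⟩ <;> rw [h1, h2]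
        · exact ⟨x.2, y.2⟩
        · exact ⟨y.2, x.2⟩
    exact key p
  · rintro ⟨f, hf, hn, ho⟩
    obtain ⟨r⟩ := hG.nonempty
    -- For `k = 0` one vertex has to be kept, because the empty graph is not a tree.
    let A : Set V := {x | (∃ j, x ∈ s(a (f j), b (f j))) ∨ (k = 0 ∧ x = r)}
    have hA : ∀ j, ∀ x ∈ s(a (f j), b (f j)), x ∈ A := fun j x hx => .inl ⟨j, hx⟩
    have hagree : ∀ x ∈ A, ∀ y ∈ A, ∀ i ∉ Set.range f, (D i x ↔ D i y) := by
      rintro x (⟨j, hj⟩ | ⟨hk, rfl⟩) y (⟨j', hj'⟩ | ⟨hk', rfl⟩) i hi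
      · rw [← hc.side_iff (fun h => hi ⟨j, h.symm⟩) hj,
          ← hc.side_iff (fun h => hi ⟨j', h.symm⟩) hj']
        exact ho i hi j j'
      · subst hk'; exact j.elim0
      · subst hk; exact j'.elim0
      · rfl
    have hne : A.Nonempty := by
      rcases Nat.eq_zero_or_pos k with h | h
      · exact ⟨r, .inr ⟨h, rfl⟩⟩
      · exact ⟨_, hA ⟨0, h⟩ _ (Sym2.mem_mk_left _ _)⟩
    have hconn : (G.induce A).Connected := by
      have := hne.to_subtype
      refine ⟨fun x y => ?_⟩
      obtain ⟨p, hp⟩ := (hG.preconnected x y).exists_isPath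
      refine ⟨p.induce A fun z hz => ?_⟩
      rcases SimpleGraph.Walk.mem_support_iff_exists_mem_edges.1 hz with rfl | ⟨e, he, hze⟩
      · exact y.2
      · obtain ⟨i, rfl⟩ : ∃ i, s(a i, b i) = e := by
          simpa [hc.edgeSet_eq] using p.edges_subset_edgeSet he
        by_contra hzA
        refine hc.path_side p hp he (hagree x x.2 y y.2 i ?_)
        rintro ⟨j, rfl⟩
        exact hzA (hA j z hze)
    let f' : Fin k → {i // a i ∈ A ∧ b i ∈ A} := fun j =>
      ⟨f j, hA j _ (Sym2.mem_mk_left _ _), hA j _ (Sym2.mem_mk_right _ _)⟩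
    have hf' : Function.Bijective f' := by
      refine ⟨fun i j h => hf (congrArg Subtype.val h), ?_⟩
      rintro ⟨i, hi, hi'⟩
      by_contra h
      refine (hc.cut i i).1 (hagree _ hi _ hi' i ?_) rfl
      rintro ⟨j, rfl⟩
      exact h ⟨j, rfl⟩
    have hc' := hc.induce A
    refine ⟨A, hc'.isCaterpillar_of_noSeparation hconn hf' hn, ?_⟩
    rw [hc'.ncard_edgeSet, ← Nat.card_eq_of_bijective f' hf', Nat.card_fin]

/-- No vertex lies in the quadrant of two cuts opposite to both edges. -/
theorem side_or_side (hc : IsCutSystem G a b D) (hG : G.Connected) {i j : E} (hij : i ≠ j)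
    (x : V) : (D j (a i) ↔ D j x) ∨ (D i (a j) ↔ D i x) := by
  -- A walk could leave this quadrant only along the edge `i` or `j`, but neither edge has an end in
  -- it.
  have key : ∀ {u z : V} (_ : G.Walk u z), ¬ (D j (a i) ↔ D j u) → ¬ (D i (a j) ↔ D i u) →
      ¬ (D j (a i) ↔ D j z) := by
    intro u z p
    induction p with
    | nil => exact fun h _ => h
    | @cons u v w h p ih =>
      intro hi hj
      have h1 := hc.adj_cut i h
      have h2 := hc.adj_cut j h
      have h3 : s(a i, b i) ≠ s(u, v) := fun h' =>
        hi (hc.side_iff hij.symm (h' ▸ Sym2.mem_mk_left u v))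
      have h4 : s(a j, b j) ≠ s(u, v) := fun h' =>
        hj (hc.side_iff hij (h' ▸ Sym2.mem_mk_left u v))
      exact ih (by tauto) (by tauto)
  by_contra! hcon
  obtain ⟨p⟩ := hG.preconnected x (a i)
  have := key p
  tauto

end IsCutSystem

/-! ### Forest orders -/

/-- A strict order in which the elements above any given one form a chain. -/
structure IsForestOrder {E : Type} (B : E → E → Prop) : Prop where
  irrefl : ∀ i, ¬ B i i
  trans : ∀ i j l, B i j → B j l → B i l
  chain : ∀ i j l, B i j → B i l → j = l ∨ B j l ∨ B l j

/-- With the root outside all marked sides, two marked sides are nested or disjoint: `side_or_side`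
at the root excludes that each of two edges lies beyond the other, and at `a i` it makes the edges
above `i` comparable. -/
theorem IsCutSystem.isForestOrder {V E : Type} {G : SimpleGraph V} {a b : E → V}
    {D : E → V → Prop} (hc : IsCutSystem G a b D) (hG : G.Connected) {r : V}
    (hr : ∀ i, ¬ D i r) : IsForestOrder fun j i => j ≠ i ∧ D i (a j) := by
  refine ⟨fun i h => h.1 rfl, ?_, ?_⟩
  · rintro i j l ⟨hij, h1⟩ ⟨hjl, h2⟩
    have h3 := hc.side_or_side hG hjl r
    have h4 := hr j
    have h5 := hr l
    refine ⟨?_, ?_⟩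
    · rintro rfl
      tauto
    · have h6 := hc.side_or_side hG hjl (a i)
      tauto
  · rintro i j l ⟨hij, h1⟩ ⟨hil, h2⟩
    by_cases hjl : j = l
    · exact .inl hjl
    · have h6 := hc.side_or_side hG hjl (a i)
      have : l ≠ j := Ne.symm hjl
      tauto

theorem IsForestOrder.wellFounded {E : Type} [Finite E] {B : E → E → Prop}
    (hB : IsForestOrder B) : WellFounded B := by
  have : IsTrans E B := ⟨hB.trans⟩
  have : Std.Irrefl B := ⟨hB.irrefl⟩
  exact Finite.wellFounded_of_trans_of_irrefl B

theorem IsForestOrder.wellFounded_flip {E : Type} [Finite E] {B : E → E → Prop}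
    (hB : IsForestOrder B) : WellFounded (flip B) := by
  have : IsTrans E (flip B) := ⟨fun i j l h1 h2 => hB.trans l j i h2 h1⟩
  have : Std.Irrefl (flip B) := ⟨hB.irrefl⟩
  exact Finite.wellFounded_of_trans_of_irrefl (flip B)

theorem IsForestOrder.exists_parent {E : Type} [Finite E] {B : E → E → Prop}
    (hB : IsForestOrder B) (j : E) :
    ∃ q : Option E, ∀ i, B j i ↔ ∃ p, q = some p ∧ (p = i ∨ B p i) := by
  by_cases h : ∃ i, B j i
  · obtain ⟨p, hp, hmin⟩ := hB.wellFounded.has_min {i | B j i} h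
    refine ⟨some p, fun i => ⟨fun hi => ⟨p, rfl, ?_⟩, ?_⟩⟩
    · rcases hB.chain j p i hp hi with h | h | h
      · exact .inl h
      · exact .inr h
      · exact absurd h (hmin i hi)
    · rintro ⟨p', h, h'⟩
      cases h
      rcases h' with rfl | h'
      · exact hp
      · exact hB.trans _ _ _ hp h'
  · exact ⟨none, fun i => ⟨fun hi => absurd ⟨i, hi⟩ h, fun ⟨p, hp, _⟩ => by cases hp⟩⟩

/-- Every finite forest order is that of the edges of a tree with a root. -/
theorem IsForestOrder.exists_tree {E : Type} [Finite E] {B : E → E → Prop}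
    (hB : IsForestOrder B) :
    ∃ (T : SimpleGraph (Option E)) (a b : E → Option E) (D : E → Option E → Prop),
      IsCutSystem T a b D ∧ T.Connected ∧ ∀ i j, D i (a j) ↔ j = i ∨ B j i := by
  choose par hpar using hB.exists_parent
  have hne : ∀ i, some i ≠ par i := fun i h => hB.irrefl i ((hpar i i).2 ⟨i, h.symm, .inl rfl⟩)
  let T : SimpleGraph (Option E) :=
    { Adj x y := ∃ i, s(some i, par i) = s(x, y)
      symm := ⟨fun x y ⟨i, hi⟩ => ⟨i, hi.trans Sym2.eq_swap⟩⟩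
      loopless := ⟨fun x ⟨i, hi⟩ => by
        rcases Sym2.eq_iff.1 hi with ⟨h1, h2⟩ | ⟨h1, h2⟩ <;> exact hne i (h1.trans h2.symm)⟩ }
  -- The vertices are the elements and a root `none`. The edge `i` joins `some i` to its parent, and
  -- its marked side consists of `i` and everything below it.
  refine ⟨T, some, par, fun i x => ∃ j, x = some j ∧ (j = i ∨ B j i), ⟨fun x y => Iff.rfl,
    fun i j => ?_⟩, ?_, fun i j => by simp⟩
  · have h1 : (∃ l, par j = some l ∧ (l = i ∨ B l i)) ↔ B j i := (hpar j i).symm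
    have h2 : (∃ l, some j = some l ∧ (l = i ∨ B l i)) ↔ j = i ∨ B j i := by simp
    rw [h1, h2]
    rcases eq_or_ne i j with rfl | h
    · simp [hB.irrefl]
    · simp [h, h.symm]
  · have hreach : ∀ j, T.Reachable (some j) none := by
      intro j
      induction j using hB.wellFounded_flip.induction with | _ j ih
      have hadj : T.Adj (some j) (par j) := ⟨j, rfl⟩
      cases hp : par j with
      | none => exact hp ▸ hadj.reachable
      | some p =>
        rw [hp] at hadj
        exact hadj.reachable.trans (ih p ((hpar j p).2 ⟨p, hp, .inl rfl⟩))
    have hall : ∀ x, T.Reachable x none := fun x => by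
      cases x with
      | none => rfl
      | some j => exact hreach j
    exact ⟨fun x y => (hall x).trans (hall y).symm⟩

/-! ### Orientation of points in convex position -/

/-- Twice the signed area of the triangle `P Q R`. -/
def orient (P Q R : Plane) : ℝ := (Q 0 - P 0) * (R 1 - P 1) - (Q 1 - P 1) * (R 0 - P 0)

theorem orient_rotate (P Q R : Plane) : orient P Q R = orient Q R P := by
  unfold orient; ring

theorem orient_swap (P Q R : Plane) : orient P R Q = - orient P Q R := by
  unfold orient; ring

theorem orient_swap_left (P Q R : Plane) : orient Q P R = - orient P Q R := by
  unfold orient; ring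

theorem Plane.ext {P Q : Plane} (h0 : P 0 = Q 0) (h1 : P 1 = Q 1) : P = Q := by
  ext i
  fin_cases i
  · exact h0
  · exact h1

theorem exists_orient_of_mem_segment {c d x : Plane} (h : x ∈ segment ℝ c d) :
    ∃ s t : ℝ, 0 ≤ s ∧ 0 ≤ t ∧ s + t = 1 ∧
      ∀ a b, orient a b x = s * orient a b c + t * orient a b d := by
  obtain ⟨s, t, hs, ht, hst, rfl⟩ := h
  refine ⟨s, t, hs, ht, hst, fun a b => ?_⟩
  obtain rfl : s = 1 - t := by linarith
  simp [orient]
  ring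

theorem orient_eq_zero_of_mem_segment {a b x : Plane} (h : x ∈ segment ℝ a b) :
    orient a b x = 0 := by
  obtain ⟨s, t, -, -, -, h⟩ := exists_orient_of_mem_segment h
  rw [h]
  unfold orient
  ring

theorem disjoint_segment_of_orient {a b c d : Plane} (hc : orient a b c ≠ 0)
    (hd : orient a b d ≠ 0) (h : 0 < orient a b c ↔ 0 < orient a b d) :
    Disjoint (segment ℝ a b) (segment ℝ c d) := by
  rw [Set.disjoint_left]
  intro x hx hx'
  obtain ⟨s, t, hs, ht, hst, hst'⟩ := exists_orient_of_mem_segment hx'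
  have h1 := hst' a b
  rw [orient_eq_zero_of_mem_segment hx] at h1
  by_cases hp : 0 < orient a b c
  · have hp' := h.1 hp
    rcases hs.eq_or_lt with rfl | hs
    · have : t = 1 := by linarith
      subst this
      linarith
    · have := mul_pos hs hp
      have := mul_nonneg ht hp'.le
      linarith
  · have hp' : orient a b d < 0 := lt_of_le_of_ne (not_lt.1 (fun h' => hp (h.2 h'))) hd
    have hp : orient a b c < 0 := lt_of_le_of_ne (not_lt.1 hp) hc
    rcases hs.eq_or_lt with rfl | hs
    · have : t = 1 := by linarith
      subst this
      linarith
    · have := mul_neg_of_pos_of_neg hs hp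
      have := mul_nonpos_of_nonneg_of_nonpos ht hp'.le
      linarith

theorem segment_inter_segment_of_orient {a b c : Plane} (h : orient a b c ≠ 0) :
    segment ℝ a b ∩ segment ℝ b c = {b} := by
  refine Set.eq_singleton_iff_unique_mem.2
    ⟨⟨right_mem_segment _ _ _, left_mem_segment _ _ _⟩, ?_⟩
  rintro x ⟨hx, s, t, hs, ht, hst, rfl⟩
  have h1 := orient_eq_zero_of_mem_segment hx
  obtain rfl : s = 1 - t := by linarith
  have h2 : orient a b ((1 - t) • b + t • c) = t * orient a b c := by
    simp [orient]
    ring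
  rw [h2] at h1
  obtain rfl : t = 0 := by simpa [h] using h1
  simp

/-- The intersection point is explicit: its weights on each segment are the distances of that
segment's ends to the line of the other, suitably normalized. -/
theorem not_disjoint_segment_of_orient {a b c d : Plane} (h1 : 0 < orient a b c)
    (h2 : orient a b d < 0) (h3 : orient c d a < 0) (h4 : 0 < orient c d b) :
    ¬ Disjoint (segment ℝ a b) (segment ℝ c d) := by
  rw [Set.not_disjoint_iff]
  have hne : orient a b c - orient a b d ≠ 0 := by linarith
  have heq : orient a b c - orient a b d = orient c d b - orient c d a := by
    unfold orient; ring
  refine ⟨(orient c d b / (orient a b c - orient a b d)) • a +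
    (- orient c d a / (orient a b c - orient a b d)) • b, ⟨_, _, ?_, ?_, ?_, rfl⟩,
    ⟨- orient a b d / (orient a b c - orient a b d),
      orient a b c / (orient a b c - orient a b d), ?_, ?_, ?_, ?_⟩⟩
  · exact div_nonneg h4.le (by linarith)
  · exact div_nonneg (by linarith) (by linarith)
  · rw [← add_div, div_eq_one_iff_eq hne]; linarith
  · exact div_nonneg (by linarith) (by linarith)
  · exact div_nonneg h1.le (by linarith)
  · rw [← add_div, div_eq_one_iff_eq hne]; linarith
  · apply Plane.ext
    · simp
      field_simp
      unfold orient
      ring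
    · simp
      field_simp
      unfold orient
      ring

/-! ### Counterclockwise numbering and crossing chords -/

section ConvexPosition

variable {ι : Type} {v : ι → Plane}

theorem not_combination_of_convexIndependent (hv : ConvexIndependent ℝ v) {x i j l : ι}
    (hi : x ≠ i) (hj : x ≠ j) (hl : x ≠ l) {α β γ : ℝ} (hα : 0 ≤ α) (hβ : 0 ≤ β) (hγ : 0 ≤ γ)
    (hs : 0 < α + β + γ)
    (h0 : (α + β + γ) * v x 0 = α * v i 0 + β * v j 0 + γ * v l 0)
    (h1 : (α + β + γ) * v x 1 = α * v i 1 + β * v j 1 + γ * v l 1) : False := by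
  have hmem : v x ∈ convexHull ℝ (v '' {i, j, l}) := by
    have hx : v x = (α / (α + β + γ)) • v i + (β / (α + β + γ)) • v j +
        (γ / (α + β + γ)) • v l := by
      apply Plane.ext
      · simp
        field_simp
        linarith
      · simp
        field_simp
        linarith
    have h := (convex_convexHull ℝ (v '' {i, j, l})).sum_mem (t := Finset.univ)
      (w := ![α / (α + β + γ), β / (α + β + γ), γ / (α + β + γ)]) (z := ![v i, v j, v l])
      (fun t _ => by fin_cases t <;> simp <;> positivity)
      (by simp [Fin.sum_univ_three]; field_simp)
      (fun t _ => subset_convexHull ℝ _ (by fin_cases t <;> simp))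
    rw [hx]
    simpa [Fin.sum_univ_three] using h
  have := hv _ _ hmem
  simp [hi, hj, hl] at this

/-- Of three collinear points one lies between the other two; the parameter `t` of the third on the
line of the first two tells which. -/
theorem orient_ne_zero (hv : ConvexIndependent ℝ v) {x y z : ι} (hxy : x ≠ y) (hxz : x ≠ z)
    (hyz : y ≠ z) : orient (v x) (v y) (v z) ≠ 0 := by
  intro h
  have hne : v x ≠ v y := fun h => hxy (hv.injective h)
  have hpos : 0 < (v y 0 - v x 0) ^ 2 + (v y 1 - v x 1) ^ 2 := by
    by_contra hcon
    refine hne (Plane.ext ?_ ?_) <;> nlinarith [sq_nonneg (v y 0 - v x 0), sq_nonneg (v y 1 - v x 1)]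
  obtain ⟨t, h0, h1⟩ : ∃ t : ℝ, v z 0 = v x 0 + t * (v y 0 - v x 0) ∧
      v z 1 = v x 1 + t * (v y 1 - v x 1) := by
    refine ⟨((v z 0 - v x 0) * (v y 0 - v x 0) + (v z 1 - v x 1) * (v y 1 - v x 1)) /
      ((v y 0 - v x 0) ^ 2 + (v y 1 - v x 1) ^ 2), ?_, ?_⟩
    · field_simp
      unfold orient at h
      linear_combination - (v y 1 - v x 1) * h
    · field_simp
      unfold orient at h
      linear_combination (v y 0 - v x 0) * h
  rcases le_total t 0 with ht | ht
  · exact not_combination_of_convexIndependent hv hxz hxy hxy (α := 1) (β := -t) (γ := 0)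
      zero_le_one (by linarith) le_rfl (by linarith) (by linarith) (by linarith)
  rcases le_total t 1 with ht' | ht'
  · exact not_combination_of_convexIndependent hv hxz.symm hyz.symm hyz.symm (α := 1 - t) (β := t)
      (γ := 0) (by linarith) ht le_rfl (by linarith) (by linarith) (by linarith)
  · exact not_combination_of_convexIndependent hv hyz hxy.symm hxy.symm (α := 1) (β := t - 1)
      (γ := 0) zero_le_one (by linarith) le_rfl (by linarith) (by linarith) (by linarith)

/-- Otherwise `v o` would lie in the triangle of the other three, the three orientations at `v o`
being its barycentric weights. -/
theorem orient_trans (hv : ConvexIndependent ℝ v) {o x y z : ι} (hx : o ≠ x) (hy : o ≠ y)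
    (hz : o ≠ z) (h1 : 0 < orient (v o) (v x) (v y))
    (h2 : 0 < orient (v o) (v y) (v z)) : 0 < orient (v o) (v x) (v z) := by
  by_contra! h3
  rw [← neg_nonneg, ← orient_swap] at h3
  refine not_combination_of_convexIndependent hv hx hy hz h2.le h3 h1.le (by linarith) ?_ ?_ <;>
  · unfold orient
    ring

/-- Otherwise `v y` would lie in the triangle of `v o`, `v x` and `v z`. -/
theorem orient_pos_of_angular (hv : ConvexIndependent ℝ v) {o x y z : ι} (hy : y ≠ o)
    (hxy : y ≠ x) (hyz : y ≠ z) (h1 : 0 < orient (v o) (v x) (v y))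
    (h2 : 0 < orient (v o) (v y) (v z)) :
    0 < orient (v x) (v y) (v z) := by
  by_contra! h4
  rw [← neg_nonneg, ← orient_swap_left] at h4
  refine not_combination_of_convexIndependent hv hy hxy hyz h4 h2.le h1.le (by linarith) ?_ ?_ <;>
  · unfold orient
    ring

/-- `pos` numbers the points of `v` counterclockwise. -/
structure IsCounterclockwise (v : ι → Plane) (pos : ι → ℕ) : Prop where
  inj : Function.Injective pos
  orient_pos : ∀ x y z, pos x < pos y → pos y < pos z → 0 < orient (v x) (v y) (v z)

/-- Points in convex position can be numbered counterclockwise, starting with any of them. -/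
theorem exists_isCounterclockwise [Finite ι] (hv : ConvexIndependent ℝ v) (o : ι) :
    ∃ pos : ι → ℕ, IsCounterclockwise v pos ∧ ∀ x, pos o ≤ pos x := by
  classical
  have := Fintype.ofFinite ι
  -- This is the order by angle around `o`, with `o` first; a point is numbered by how many precede
  -- it.
  let r : ι → ι → Prop := fun x y => y ≠ o ∧ (x = o ∨ 0 < orient (v o) (v x) (v y))
  have hself : ∀ x, orient (v o) (v x) (v x) = 0 := fun x => by unfold orient; ring
  have hirr : ∀ x, ¬ r x x := by
    rintro x ⟨h1, h2 | h2⟩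
    · exact h1 h2
    · exact (hself x ▸ h2).ne rfl
  have htrans : ∀ x y z, r x y → r y z → r x z := by
    rintro x y z ⟨hy, hxy⟩ ⟨hz, hyz⟩
    refine ⟨hz, ?_⟩
    rcases eq_or_ne x o with rfl | hx
    · exact .inl rfl
    have h1 := hxy.resolve_left hx
    have h2 := hyz.resolve_left hy
    exact .inr (orient_trans hv hx.symm hy.symm hz.symm h1 h2)
  have htot : ∀ x y, x ≠ y → r x y ∨ r y x := by
    intro x y hxy
    rcases eq_or_ne x o with rfl | hx
    · exact .inl ⟨hxy.symm, .inl rfl⟩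
    rcases eq_or_ne y o with rfl | hy
    · exact .inr ⟨hx, .inl rfl⟩
    rcases lt_or_gt_of_ne (orient_ne_zero hv hx.symm hy.symm hxy) with h | h
    · exact .inr ⟨hx, .inr (by rw [orient_swap]; linarith)⟩
    · exact .inl ⟨hy, .inr h⟩
  let pos : ι → ℕ := fun y => (Finset.univ.filter (r · y)).card
  have hmono : ∀ x y, r x y → pos x < pos y := by
    intro x y hxy
    refine Finset.card_lt_card (Finset.ssubset_iff_of_subset ?_ |>.2 ⟨x, ?_, ?_⟩)
    · intro z hz
      simp only [Finset.mem_filter_univ] at hz ⊢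
      exact htrans _ _ _ hz hxy
    · simpa using hxy
    · simpa using hirr x
  have hinj : Function.Injective pos := by
    intro x y hxy
    by_contra hne
    rcases htot x y hne with h | h
    · exact (hmono _ _ h).ne hxy
    · exact (hmono _ _ h).ne hxy.symm
  have hr : ∀ x y, pos x < pos y → r x y := by
    intro x y hxy
    rcases htot x y (fun h => by subst h; omega) with h | h
    · exact h
    · have := hmono _ _ h
      omega
  refine ⟨pos, ⟨hinj, fun x y z hxy hyz => ?_⟩, fun x => ?_⟩
  · obtain ⟨hy, h1⟩ := hr x y hxy
    obtain ⟨hz, h2⟩ := hr y z hyz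
    have h2 := h2.resolve_left hy
    rcases eq_or_ne x o with rfl | hx
    · exact h2
    · refine orient_pos_of_angular hv hy ?_ ?_ (h1.resolve_left hx) h2
      · rintro rfl; omega
      · rintro rfl; omega
  · rcases eq_or_ne o x with rfl | h
    · rfl
    · exact (hmono o x ⟨h.symm, .inl rfl⟩).le

/-- The number of `z` is between those of `x` and `y`. -/
def Between (pos : ι → ℕ) (x y z : ι) : Prop :=
  (pos x < pos z ∧ pos z < pos y) ∨ (pos y < pos z ∧ pos z < pos x)

variable {pos : ι → ℕ}

theorem iff_not_iff_iff_not {P Q R : Prop} : ((P ↔ ¬ Q) ↔ (P ↔ ¬ R)) ↔ (Q ↔ R) := by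
  by_cases hP : P <;> simp [hP, not_iff_not]

theorem IsCounterclockwise.orient_pos_iff (hp : IsCounterclockwise v pos) {x y z : ι}
    (hxy : x ≠ y) (hxz : x ≠ z) (hyz : y ≠ z) :
    0 < orient (v x) (v y) (v z) ↔ (pos x < pos y ↔ ¬ Between pos x y z) := by
  have h1 := hp.inj.ne hxy
  have h2 := hp.inj.ne hxz
  have h3 := hp.inj.ne hyz
  have e1 := hp.orient_pos x y z
  have e2 := hp.orient_pos y z x
  have e3 := hp.orient_pos z x y
  have e4 := hp.orient_pos x z y
  have e5 := hp.orient_pos z y x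
  have e6 := hp.orient_pos y x z
  rw [← orient_rotate] at e2
  rw [orient_rotate] at e3
  rw [orient_swap] at e4
  rw [← orient_rotate, orient_swap, neg_pos] at e5
  rw [orient_swap_left] at e6
  rw [neg_pos] at e4 e6
  unfold Between
  constructor
  · intro h
    by_contra hcon
    have : orient (v x) (v y) (v z) < 0 := by
      rcases lt_or_gt_of_ne h1 with a | a <;> rcases lt_or_gt_of_ne h2 with b | b <;>
      rcases lt_or_gt_of_ne h3 with c | c <;>
      first | omega | exact e4 b (by omega) | exact e5 (by omega) (by omega) | exact e6 (by omega) (by omega)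
    linarith
  · intro h
    rcases lt_or_gt_of_ne h1 with a | a <;> rcases lt_or_gt_of_ne h2 with b | b <;>
      rcases lt_or_gt_of_ne h3 with c | c <;>
      first | omega | exact e1 a c | exact e2 (by omega) (by omega) | exact e3 (by omega) (by omega)

theorem IsCounterclockwise.orient_ne_zero (hp : IsCounterclockwise v pos) {x y z : ι}
    (hxy : x ≠ y) (hxz : x ≠ z) (hyz : y ≠ z) : orient (v x) (v y) (v z) ≠ 0 := by
  intro h
  have h1 := hp.orient_pos_iff hxy hxz hyz
  have h2 := hp.orient_pos_iff hxy.symm hyz hxz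
  rw [orient_swap_left, h] at h2
  rw [h] at h1
  have := hp.inj.ne hxy
  have := hp.inj.ne hxz
  have := hp.inj.ne hyz
  simp only [neg_zero, lt_irrefl, false_iff] at h1 h2
  unfold Between at h1 h2
  omega

/-- Two chords of a convex polygon cross exactly when their ends interleave. -/
theorem IsCounterclockwise.disjoint_iff (hp : IsCounterclockwise v pos) {x y z w : ι}
    (hxy : x ≠ y) (hxz : x ≠ z) (hyz : y ≠ z) (hxw : x ≠ w) (hyw : y ≠ w) :
    Disjoint (segment ℝ (v x) (v y)) (segment ℝ (v z) (v w)) ↔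
      (Between pos x y z ↔ Between pos x y w) := by
  have e1 := hp.orient_pos_iff hxy hxz hyz
  have e2 := hp.orient_pos_iff hxy hxw hyw
  have n1 := hp.orient_ne_zero hxy hxz hyz
  have n2 := hp.orient_ne_zero hxy hxw hyw
  constructor
  · intro hd
    by_contra hcon
    have hzw : z ≠ w := by rintro rfl; exact hcon .rfl
    have e3 := hp.orient_pos_iff hzw hxz.symm hxw.symm
    have e4 := hp.orient_pos_iff hzw hyz.symm hyw.symm
    have n3 := hp.orient_ne_zero hzw hxz.symm hxw.symm
    have n4 := hp.orient_ne_zero hzw hyz.symm hyw.symm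
    have i1 := hp.inj.ne hxy
    have i2 := hp.inj.ne hxz
    have i3 := hp.inj.ne hyz
    have i4 := hp.inj.ne hxw
    have i5 := hp.inj.ne hyw
    have i6 := hp.inj.ne hzw
    have hcon' : ¬ (Between pos z w x ↔ Between pos z w y) := by
      unfold Between at hcon ⊢
      omega
    -- Each chord has the ends of the other on opposite sides; this identity fixes how the two sign
    -- changes match, ruling out two of the four combinations.
    have hsum : orient (v x) (v y) (v z) - orient (v x) (v y) (v w) =
        orient (v z) (v w) (v y) - orient (v z) (v w) (v x) := by
      unfold orient; ring
    have k1 : ¬ (0 < orient (v x) (v y) (v z) ↔ 0 < orient (v x) (v y) (v w)) := by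
      rw [e1, e2, iff_not_iff_iff_not]
      exact hcon
    have k2 : ¬ (0 < orient (v z) (v w) (v x) ↔ 0 < orient (v z) (v w) (v y)) := by
      rw [e3, e4, iff_not_iff_iff_not]
      exact hcon'
    have pos_or (α β : ℝ) (hα : α ≠ 0) (hβ : β ≠ 0) (h : ¬ (0 < α ↔ 0 < β)) :
        (0 < α ∧ β < 0) ∨ (α < 0 ∧ 0 < β) := by
      rcases lt_or_gt_of_ne hα with a | a <;> rcases lt_or_gt_of_ne hβ with b | b
      · exact absurd (iff_of_false a.not_gt b.not_gt) h
      · exact .inr ⟨a, b⟩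
      · exact .inl ⟨a, b⟩
      · exact absurd (iff_of_true a b) h
    rcases pos_or _ _ n1 n2 k1 with ⟨a1, a2⟩ | ⟨a1, a2⟩ <;>
      rcases pos_or _ _ n3 n4 k2 with ⟨a3, a4⟩ | ⟨a3, a4⟩
    · linarith
    · exact not_disjoint_segment_of_orient a1 a2 a3 a4 hd
    · rw [segment_symm ℝ (v z)] at hd
      rw [← neg_neg (orient (v z) (v w) (v x)), ← orient_swap_left, neg_pos] at a3
      rw [← neg_neg (orient (v z) (v w) (v y)), ← orient_swap_left, neg_neg_iff_pos] at a4
      exact not_disjoint_segment_of_orient a2 a1 a3 a4 hd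
    · linarith
  · intro h
    exact disjoint_segment_of_orient n1 n2 (by rw [e1, e2, h])

end ConvexPosition
/-! ### Unobstructed lists of endpoints -/

section Lists

variable {n : ℕ}

/-- The index of the segment that an endpoint belongs to. -/
def segIndex : Fin n ⊕ Fin n → Fin n := Sum.elim id id

/-- The left or right endpoint of a segment. -/
def endpoint (i : Fin n) (b : Bool) : Fin n ⊕ Fin n := if b then .inl i else .inr i

@[simp] theorem segIndex_endpoint (i : Fin n) (b : Bool) : segIndex (endpoint i b) = i := by
  cases b <;> rfl

/-- The endpoints of a list of directed segments. -/
def endpoints : List (Fin n × Bool) → List (Fin n ⊕ Fin n)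
  | [] => []
  | (i, b) :: l => endpoint i b :: endpoint i (!b) :: endpoints l

/-- In the numbering `pos`, the segment `j` lies inside the segment `i`. -/
def Nested (pos : Fin n ⊕ Fin n → ℕ) (j i : Fin n) : Prop :=
  min (pos (.inl i)) (pos (.inr i)) < min (pos (.inl j)) (pos (.inr j)) ∧
    max (pos (.inl j)) (pos (.inr j)) < max (pos (.inl i)) (pos (.inr i))

/-- In the numbering `pos`, no two segments cross. -/
structure IsNoncrossing (pos : Fin n ⊕ Fin n → ℕ) : Prop where
  inj : Function.Injective pos
  between_iff : ∀ i j, j ≠ i →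
    (Between pos (.inl i) (.inr i) (.inl j) ↔ Between pos (.inl i) (.inr i) (.inr j))

/-- No segment of the polygonal chain through the listed points separates two later points. -/
def Unobstructed {ι : Type} (pos : ι → ℕ) : List ι → Prop
  | x :: y :: l => (∀ z ∈ l, ∀ w ∈ l, Between pos x y z ↔ Between pos x y w) ∧
      Unobstructed pos (y :: l)
  | _ => True

variable {pos : Fin n ⊕ Fin n → ℕ}

theorem IsNoncrossing.ne (hp : IsNoncrossing pos) (i : Fin n) : pos (.inl i) ≠ pos (.inr i) :=
  hp.inj.ne Sum.inl_ne_inr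

theorem IsNoncrossing.cases (hp : IsNoncrossing pos) {i j : Fin n} (hij : i ≠ j) :
    max (pos (.inl i)) (pos (.inr i)) < min (pos (.inl j)) (pos (.inr j)) ∨
    max (pos (.inl j)) (pos (.inr j)) < min (pos (.inl i)) (pos (.inr i)) ∨
    Nested pos i j ∨ Nested pos j i := by
  have h1 := hp.between_iff i j hij.symm
  have h2 := hp.between_iff j i hij
  have := hp.ne i
  have := hp.ne j
  have := hp.inj.ne (Sum.inl_injective.ne hij : (Sum.inl i : Fin n ⊕ Fin n) ≠ .inl j)
  have := hp.inj.ne (Sum.inr_injective.ne hij : (Sum.inr i : Fin n ⊕ Fin n) ≠ .inr j)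
  have := hp.inj.ne (Sum.inl_ne_inr : (Sum.inl i : Fin n ⊕ Fin n) ≠ .inr j)
  have := hp.inj.ne (Sum.inr_ne_inl : (Sum.inr i : Fin n ⊕ Fin n) ≠ .inl j)
  unfold Between at h1 h2
  unfold Nested
  omega

theorem IsNoncrossing.between_iff_nested (hp : IsNoncrossing pos) {i j : Fin n} (hij : i ≠ j) :
    Between pos (.inl i) (.inr i) (.inl j) ↔ Nested pos j i := by
  have h := hp.cases hij
  have h1 := hp.ne j
  unfold Between
  unfold Nested at *
  omega

theorem IsNoncrossing.isForestOrder (hp : IsNoncrossing pos) : IsForestOrder (Nested pos) := by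
  refine ⟨fun i h => lt_irrefl _ h.1, fun i j l h1 h2 => ⟨h2.1.trans h1.1, h1.2.trans h2.2⟩, ?_⟩
  intro i j l h1 h2
  by_cases hjl : j = l
  · exact .inl hjl
  · have h := hp.cases hjl
    unfold Nested at *
    omega

/-- The link from `y` to `h` is harmless: `y` lies beyond all remaining points and `h` is the first
or last of these, so either all or none of the others are between them. -/
theorem unobstructed_cons_cons {ι : Type} {pos : ι → ℕ} {x y h : ι} {t : List ι}
    (hxy : (∀ w ∈ h :: t, Between pos x y w) ∨ ∀ w ∈ h :: t, ¬ Between pos x y w)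
    (hy : (∀ w ∈ h :: t, pos y < pos w) ∨ ∀ w ∈ h :: t, pos w < pos y)
    (hh : (∀ w ∈ t, pos h < pos w) ∨ ∀ w ∈ t, pos w < pos h)
    (ht : Unobstructed pos (h :: t)) : Unobstructed pos (x :: y :: h :: t) := by
  refine ⟨fun z hz w hw => ?_, fun z hz w hw => ?_, ht⟩
  · rcases hxy with hxy | hxy
    · exact iff_of_true (hxy z hz) (hxy w hw)
    · exact iff_of_false (hxy z hz) (hxy w hw)
  · unfold Between
    rcases hy with hy | hy <;> rcases hh with hh | hh
    all_goals
      have := hy h (by simp)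
      have := hy z (by simp [hz])
      have := hy w (by simp [hw])
      have := hh z hz
      have := hh w hw
      omega

theorem segIndex_of_mem_endpoints {l : List (Fin n × Bool)} {w : Fin n ⊕ Fin n}
    (hw : w ∈ endpoints l) : segIndex w ∈ l.map Prod.fst := by
  induction l with
  | nil => cases hw
  | cons p l ih =>
    obtain ⟨i, b⟩ := p
    simp only [endpoints, List.mem_cons] at hw
    rcases hw with rfl | rfl | hw
    · simp
    · simp
    · exact List.mem_cons_of_mem _ (ih hw)

/-- Segments that can be arranged so that no one contains an earlier one, or separates later ones,
can be passed through by an unobstructed list. -/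
theorem IsNoncrossing.exists_unobstructed (hp : IsNoncrossing pos) (rank : Fin n → ℕ)
    (R : Finset (Fin n)) (hne : R.Nonempty)
    (hinj : ∀ i ∈ R, ∀ j ∈ R, rank i = rank j → i = j)
    (hear : ∀ i ∈ R, ∀ j ∈ R, rank i < rank j → ¬ Nested pos i j)
    (hlat : ∀ i ∈ R, ∀ j ∈ R, ∀ l ∈ R, rank i < rank j → rank i < rank l →
      (Nested pos j i ↔ Nested pos l i)) :
    ∃ gs : List (Fin n × Bool), (gs.map Prod.fst).Nodup ∧ (∀ i, i ∈ gs.map Prod.fst ↔ i ∈ R) ∧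
      Unobstructed pos (endpoints gs) ∧ ∃ h t, endpoints gs = h :: t ∧
        ((∀ w ∈ t, pos h < pos w) ∨ ∀ w ∈ t, pos w < pos h) := by
  classical
  induction R using Finset.strongInduction with | _ R ih
  obtain ⟨x, hx, hxmin⟩ := R.exists_min_image (fun i => min (pos (.inl i)) (pos (.inr i))) hne
  obtain ⟨y, hy, hymax⟩ := R.exists_max_image (fun i => max (pos (.inl i)) (pos (.inr i))) hne
  -- The next segment `s` and its direction: it separates no remaining endpoints, its second end
  -- lies beyond all of them, and its first end is extreme even together with the second. The last
  -- property is the invariant of the induction.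
  obtain ⟨s, hs, b, h1, h2, h3⟩ : ∃ s ∈ R, ∃ b,
      ((∀ w, segIndex w ∈ R.erase s → Between pos (endpoint s b) (endpoint s (!b)) w) ∨
        ∀ w, segIndex w ∈ R.erase s → ¬ Between pos (endpoint s b) (endpoint s (!b)) w) ∧
      ((∀ w, segIndex w ∈ R.erase s → pos (endpoint s (!b)) < pos w) ∨
        ∀ w, segIndex w ∈ R.erase s → pos w < pos (endpoint s (!b))) ∧
      ((pos (endpoint s b) < pos (endpoint s (!b)) ∧
          ∀ w, segIndex w ∈ R.erase s → pos (endpoint s b) < pos w) ∨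
        (pos (endpoint s (!b)) < pos (endpoint s b) ∧
          ∀ w, segIndex w ∈ R.erase s → pos w < pos (endpoint s b))) := by
    have hflag : ∀ i, ∃ b, pos (endpoint i b) = min (pos (.inl i)) (pos (.inr i)) ∧
        pos (endpoint i (!b)) = max (pos (.inl i)) (pos (.inr i)) := by
      intro i
      rcases le_total (pos (.inl i)) (pos (.inr i)) with h | h
      · exact ⟨true, by simp [endpoint, h], by simp [endpoint, h]⟩
      · exact ⟨false, by simp [endpoint, h], by simp [endpoint, h]⟩
    have hw : ∀ w : Fin n ⊕ Fin n, min (pos (.inl (segIndex w))) (pos (.inr (segIndex w))) ≤ pos w ∧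
        pos w ≤ max (pos (.inl (segIndex w))) (pos (.inr (segIndex w))) := by
      rintro (w | w) <;> simp [segIndex]
    have hxw : ∀ w, segIndex w ∈ R.erase x →
        min (pos (.inl x)) (pos (.inr x)) < pos w := by
      intro w hwR
      have h1 := hxmin _ (Finset.mem_of_mem_erase hwR)
      have h2 := hp.cases (Finset.ne_of_mem_erase hwR)
      have h3 := hw w
      unfold Nested at h2
      omega
    have hyw : ∀ w, segIndex w ∈ R.erase y →
        pos w < max (pos (.inl y)) (pos (.inr y)) := by
      intro w hwR
      have h1 := hymax _ (Finset.mem_of_mem_erase hwR)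
      have h2 := hp.cases (Finset.ne_of_mem_erase hwR)
      have h3 := hw w
      unfold Nested at h2
      omega
    rcases eq_or_ne x y with rfl | hxy
    · obtain ⟨b, hb1, hb2⟩ := hflag x
      have hne := hp.ne x
      refine ⟨x, hx, b, .inl fun w h => .inl ?_, .inr fun w h => ?_, .inl ⟨by omega, fun w h => ?_⟩⟩
      all_goals
        have := hxw w h
        have := hyw w h
        omega
    -- Let `x` have the lower rank. No earlier segment is inside it; the later ones are all inside
    -- or all outside, and `y` is outside. The other case is symmetric.
    have hempty : (∀ j ∈ R, ¬ Nested pos j x) ∨ ∀ j ∈ R, ¬ Nested pos j y := by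
      have hnxy : ¬ Nested pos x y ∧ ¬ Nested pos y x := by
        have := hxmin y hy
        have := hymax x hx
        unfold Nested
        omega
      rcases lt_or_gt_of_ne fun h => hxy (hinj x hx y hy h) with h | h
      · refine .inl fun j hj hjx => ?_
        rcases lt_trichotomy (rank j) (rank x) with h' | h' | h'
        · exact hear j hj x hx h' hjx
        · obtain rfl := hinj j hj x hx h'
          exact lt_irrefl _ hjx.1
        · exact hnxy.2 ((hlat x hx j hj y hy h' h).1 hjx)
      · refine .inr fun j hj hjy => ?_
        rcases lt_trichotomy (rank j) (rank y) with h' | h' | h'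
        · exact hear j hj y hy h' hjy
        · obtain rfl := hinj j hj y hy h'
          exact lt_irrefl _ hjy.1
        · exact hnxy.1 ((hlat y hy j hj x hx h' h).1 hjy)
    rcases hempty with he | he
    · obtain ⟨b, hb1, hb2⟩ := hflag x
      have hne := hp.ne x
      have key : ∀ w, segIndex w ∈ R.erase x →
          max (pos (.inl x)) (pos (.inr x)) < pos w := by
        intro w hwR
        have h1 := hxmin _ (Finset.mem_of_mem_erase hwR)
        have h2 := hp.cases (Finset.ne_of_mem_erase hwR)
        have h3 := hw w
        have h4 := he _ (Finset.mem_of_mem_erase hwR)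
        unfold Nested at h2 h4
        omega
      refine ⟨x, hx, b, .inr fun w h => ?_, .inl fun w h => ?_,
        .inl ⟨by omega, fun w h => ?_⟩⟩
      · have := key w h
        unfold Between
        omega
      · have := key w h
        omega
      · have := hxw w h
        omega
    · obtain ⟨b, hb1, hb2⟩ := hflag y
      have hne := hp.ne y
      have key : ∀ w, segIndex w ∈ R.erase y →
          pos w < min (pos (.inl y)) (pos (.inr y)) := by
        intro w hwR
        have h1 := hymax _ (Finset.mem_of_mem_erase hwR)
        have h2 := hp.cases (Finset.ne_of_mem_erase hwR)
        have h3 := hw w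
        have h4 := he _ (Finset.mem_of_mem_erase hwR)
        unfold Nested at h2 h4
        omega
      refine ⟨y, hy, !b, .inr fun w h => ?_, .inr fun w h => ?_,
        .inr ⟨by rw [Bool.not_not]; omega, fun w h => ?_⟩⟩
      · have := key w h
        rw [Bool.not_not]
        unfold Between
        omega
      · have := key w h
        rw [Bool.not_not]
        omega
      · have := hyw w h
        omega
  rcases (R.erase s).eq_empty_or_nonempty with hemp | hR
  · refine ⟨[(s, b)], by simp, fun i => ?_, ⟨by simp [endpoints], trivial⟩, _, _, rfl, ?_⟩
    · have : R = {s} := by rw [← Finset.insert_erase hs, hemp]; rfl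
      simp [this]
    · have hne : pos (endpoint s b) ≠ pos (endpoint s !b) :=
        hp.inj.ne (by cases b <;> simp [endpoint])
      simp only [endpoints, List.mem_singleton, forall_eq]
      exact lt_or_gt_of_ne hne
  obtain ⟨gs, hnd, hmem, hun, h, t, hht, hends⟩ := ih (R.erase s) (Finset.erase_ssubset hs) hR
    (fun i hi j hj => hinj i (Finset.mem_of_mem_erase hi) j (Finset.mem_of_mem_erase hj))
    (fun i hi j hj => hear i (Finset.mem_of_mem_erase hi) j (Finset.mem_of_mem_erase hj))
    (fun i hi j hj l hl => hlat i (Finset.mem_of_mem_erase hi) j (Finset.mem_of_mem_erase hj) l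
      (Finset.mem_of_mem_erase hl))
  have hseg : ∀ w ∈ h :: t, segIndex w ∈ R.erase s := fun w hw =>
    (hmem _).1 (segIndex_of_mem_endpoints (hht ▸ hw))
  refine ⟨(s, b) :: gs, ?_, fun i => ?_, ?_, _, _, rfl, ?_⟩
  · rw [List.map_cons, List.nodup_cons]
    exact ⟨fun h => Finset.notMem_erase s R ((hmem s).1 h), hnd⟩
  · rw [List.map_cons, List.mem_cons, hmem, ← Finset.mem_insert, Finset.insert_erase hs]
  · rw [endpoints, hht]
    rw [hht] at hun
    exact unobstructed_cons_cons (h1.imp (fun h w hw => h w (hseg w hw)) fun h w hw => h w (hseg w hw))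
      (h2.imp (fun h w hw => h w (hseg w hw)) fun h w hw => h w (hseg w hw)) hends hun
  · rw [hht]
    refine h3.imp (fun h w hw => ?_) fun h w hw => ?_
    · rcases List.mem_cons.1 hw with rfl | hw
      · exact h.1
      · exact h.2 w (hseg w hw)
    · rcases List.mem_cons.1 hw with rfl | hw
      · exact h.1
      · exact h.2 w (hseg w hw)

end Lists
/-! ### Alternating paths and arrangements -/

namespace SegmentFamily

variable {n : ℕ} {S : SegmentFamily n}

/-- The segment `j` lies on the left of the segment `i`. -/
def OnLeft (S : SegmentFamily n) (j i : Fin n) : Prop :=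
  0 < orient (S.left i) (S.right i) (S.left j)

/-- The endpoints of the segments. -/
def point (S : SegmentFamily n) : Fin n ⊕ Fin n → Plane := Sum.elim S.left S.right

theorem exists_numbering (hS : S.InConvexPosition) (o : Fin n ⊕ Fin n) :
    ∃ pos, IsCounterclockwise S.point pos ∧ ∀ x, pos o ≤ pos x :=
  exists_isCounterclockwise hS o

theorem isNoncrossing {pos : Fin n ⊕ Fin n → ℕ} (hp : IsCounterclockwise S.point pos) :
    IsNoncrossing pos := by
  refine ⟨hp.inj, fun i j hij => ?_⟩
  rw [← hp.disjoint_iff Sum.inl_ne_inr (Sum.inl_injective.ne hij.symm) Sum.inr_ne_inl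
    Sum.inl_ne_inr (Sum.inr_injective.ne hij.symm)]
  exact S.disjoint i j hij.symm

theorem onLeft_iff_iff {pos : Fin n ⊕ Fin n → ℕ} (hp : IsCounterclockwise S.point pos)
    {e f g : Fin n} (hf : f ≠ e) (hg : g ≠ e) :
    (S.OnLeft f e ↔ S.OnLeft g e) ↔ (Nested pos f e ↔ Nested pos g e) := by
  have h : ∀ t, t ≠ e → (S.OnLeft t e ↔ (pos (.inl e) < pos (.inr e) ↔ ¬ Nested pos t e)) := by
    intro t ht
    rw [← (isNoncrossing hp).between_iff_nested ht.symm]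
    exact hp.orient_pos_iff Sum.inl_ne_inr (Sum.inl_injective.ne ht.symm) Sum.inr_ne_inl
  rw [h f hf, h g hg, iff_not_iff_iff_not]

/-- Both ends of a segment lie on the same side of any other, so crossing can be read off from the
sides of whole segments. -/
theorem disjoint_iff_onLeft (hS : S.InConvexPosition) {i : Fin n} {x y : Fin n ⊕ Fin n}
    (hx : segIndex x ≠ i) (hy : segIndex y ≠ i) :
    Disjoint (segment ℝ (S.left i) (S.right i)) (segment ℝ (S.point x) (S.point y)) ↔
      (S.OnLeft (segIndex x) i ↔ S.OnLeft (segIndex y) i) := by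
  obtain ⟨pos, hp, -⟩ := exists_numbering hS (.inl i)
  have hnc := isNoncrossing hp
  have hne : ∀ w : Fin n ⊕ Fin n, segIndex w ≠ i → Sum.inl i ≠ w ∧ Sum.inr i ≠ w := by
    rintro w hw
    constructor <;> rintro rfl <;> exact hw rfl
  have hb : ∀ w : Fin n ⊕ Fin n, segIndex w ≠ i →
      (Between pos (.inl i) (.inr i) w ↔ Nested pos (segIndex w) i) := by
    intro w hw
    rw [← hnc.between_iff_nested hw.symm]
    rcases w with w | w
    · rfl
    · exact (hnc.between_iff i w hw).symm
  rw [onLeft_iff_iff hp hx hy, ← hb x hx, ← hb y hy]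
  exact hp.disjoint_iff Sum.inl_ne_inr (hne x hx).1 (hne x hx).2 (hne y hy).1 (hne y hy).2

theorem index_inj {j j' : Fin n} (h : s(S.left j, S.right j) = s(S.left j', S.right j')) :
    j = j' := by
  by_contra hne
  refine Set.disjoint_left.1 (S.disjoint j j' hne) (left_mem_segment _ _ _) ?_
  rcases Sym2.eq_iff.1 h with ⟨h, -⟩ | ⟨h, -⟩ <;> rw [h]
  · exact left_mem_segment _ _ _
  · exact right_mem_segment _ _ _

end SegmentFamily

namespace PolygonalChain

variable {n : ℕ} {S : SegmentFamily n} {c : PolygonalChain}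

theorem EdgeIs.edge_eq {i : Fin c.length} {j : Fin n} (h : c.EdgeIs S i j) :
    c.edge i = segment ℝ (S.left j) (S.right j) := by
  unfold edge
  rcases Sym2.eq_iff.1 h with ⟨h1, h2⟩ | ⟨h1, h2⟩ <;> rw [h1, h2]
  exact segment_symm _ _ _

theorem EdgeIs.exists_points {i : Fin c.length} {j : Fin n} (h : c.EdgeIs S i j) :
    ∃ x y, segIndex x = j ∧ segIndex y = j ∧ c.vertex i.castSucc = S.point x ∧
      c.vertex i.succ = S.point y := by
  rcases Sym2.eq_iff.1 h with ⟨h1, h2⟩ | ⟨h1, h2⟩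
  · exact ⟨.inl j, .inr j, rfl, rfl, h1, h2⟩
  · exact ⟨.inr j, .inl j, rfl, rfl, h1, h2⟩

/-- A part of an alternating path that does not meet the segment `s` stays on one side of it. -/
theorem onLeft_iff_of_disjoint (hS : S.InConvexPosition) {e : ℕ}
    (he : ∀ i : Fin c.length, (∃ j, c.EdgeIs S i j) ↔ Even ((i : ℕ) + e)) {s : Fin n}
    {i₀ : Fin c.length} {j₀ : Fin n} (h₀ : c.EdgeIs S i₀ j₀) (t : ℕ) :
    ∀ (i₁ : Fin c.length) (j₁ : Fin n), c.EdgeIs S i₁ j₁ → (i₁ : ℕ) = i₀ + 2 * t →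
      (∀ u, i₀ ≤ u → u ≤ i₁ → Disjoint (segment ℝ (S.left s) (S.right s)) (c.edge u)) →
      (S.OnLeft j₀ s ↔ S.OnLeft j₁ s) := by
  induction t with
  | zero =>
    intro i₁ j₁ h₁ ht _
    obtain rfl : i₁ = i₀ := Fin.ext ht
    rw [SegmentFamily.index_inj (h₀.symm.trans h₁)]
  | succ t ih =>
    intro i₁ j₁ h₁ ht hd
    have hi₁ := i₁.2
    -- `i₂` is the last segment of the family before `i₁`, and `i₃` is the link between the two.
    let i₂ : Fin c.length := ⟨i₀ + 2 * t, by omega⟩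
    let i₃ : Fin c.length := ⟨i₀ + 2 * t + 1, by omega⟩
    have hle : ∀ u v : Fin c.length, (u : ℕ) ≤ v → u ≤ v := fun u v h => h
    obtain ⟨j₂, h₂⟩ : ∃ j, c.EdgeIs S i₂ j := by
      rw [he]
      have := (he i₀).1 ⟨j₀, h₀⟩
      simp only [i₂]
      rw [Nat.even_iff] at *
      omega
    rw [ih i₂ j₂ h₂ rfl fun u hu hu' => hd u hu (hu'.trans (hle _ _ (by simp only [i₂]; omega)))]
    have hne : ∀ u j, c.EdgeIs S u j → i₀ ≤ u → u ≤ i₁ → j ≠ s := by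
      rintro u j hu h h' rfl
      have := hd u h h'
      rw [hu.edge_eq, disjoint_self] at this
      exact (Set.nonempty_of_mem (left_mem_segment ℝ (S.left j) (S.right j))).ne_empty this
    obtain ⟨-, x, -, hx, -, hx'⟩ := h₂.exists_points
    obtain ⟨y, -, hy, -, hy', -⟩ := h₁.exists_points
    have hd₃ := hd i₃ (hle _ _ (by simp only [i₃]; omega)) (hle _ _ (by simp only [i₃]; omega))
    have e1 : i₃.castSucc = i₂.succ := Fin.ext (by simp [i₂, i₃])
    have e2 : i₃.succ = i₁.castSucc := Fin.ext (by simp [i₃]; omega)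
    unfold edge at hd₃
    rw [e1, e2, hx', hy'] at hd₃
    have h1 := hne i₂ j₂ h₂ (hle _ _ (by simp only [i₂]; omega))
      (hle _ _ (by simp only [i₂]; omega))
    have h2 := hne i₁ j₁ h₁ (hle _ _ (by omega)) le_rfl
    have := (SegmentFamily.disjoint_iff_onLeft hS (hx ▸ h1) (hy ▸ h2)).1 hd₃
    rwa [hx, hy] at this

end PolygonalChain

/-- The arrangement is the order of traversal. Two segments before `i`, or two after it, are joined
by a part of the chain that is not adjacent to `i` and hence misses it; compatibility gives the same
for omitted segments. -/
theorem IsAlternatingPath.exists_arrangement {n : ℕ} {S : SegmentFamily n}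
    (hS : S.InConvexPosition) {c : PolygonalChain} (hc : IsAlternatingPath S c) :
    ∃ f : Fin (throughCount S c) → Fin n, Function.Injective f ∧ NoSeparation S.OnLeft f ∧
      (IsCompatible S c → ∀ e ∉ Set.range f, ∀ j j', S.OnLeft (f j) e ↔ S.OnLeft (f j') e) := by
  classical
  obtain ⟨⟨hnd, hcons, hdis⟩, e, he⟩ := hc
  let J : Finset (Fin c.length) := Finset.univ.filter fun i => Even ((i : ℕ) + e)
  let g : Fin J.card ↪o Fin c.length := J.orderEmbOfFin rfl
  have hgJ : ∀ t, Even ((g t : ℕ) + e) := fun t =>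
    (Finset.mem_filter.1 (J.orderEmbOfFin_mem rfl t)).2
  have hJg : ∀ i : Fin c.length, Even ((i : ℕ) + e) → ∃ t, g t = i := fun i hi => by
    have : i ∈ Set.range g := by
      rw [Finset.range_orderEmbOfFin]
      simpa [J] using hi
    exact this
  choose f hf using fun t => (he (g t)).2 (hgJ t)
  have hgap : ∀ t t', t < t' → (g t : ℕ) + 1 < g t' := by
    intro t t' h
    have h1 : (g t : ℕ) < g t' := g.lt_iff_lt.2 h
    have h2 := hgJ t
    have h3 := hgJ t'
    rw [Nat.even_iff] at h2 h3
    omega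
  have hdisj : ∀ t t', t < t' → Disjoint (c.edge (g t)) (c.edge (g t')) := fun t t' h =>
    hdis _ _ (hgap t t' h)
  have hnonempty : ∀ i, (c.edge i).Nonempty := fun i => ⟨_, left_mem_segment _ _ _⟩
  have hinj : Function.Injective f := by
    intro t t' h
    have hE : c.edge (g t) = c.edge (g t') := by rw [(hf t).edge_eq, (hf t').edge_eq, h]
    by_contra hne
    rcases lt_or_gt_of_ne hne with h | h
    · have := hdisj _ _ h
      rw [hE, disjoint_self] at this
      exact (hnonempty _).ne_empty this
    · have := hdisj _ _ h
      rw [hE, disjoint_self] at this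
      exact (hnonempty _).ne_empty this
  have hthrough : ∀ j, c.GoesThrough S j → ∃ t, f t = j := by
    rintro j ⟨i, hi⟩
    obtain ⟨t, rfl⟩ := hJg i ((he i).1 ⟨j, hi⟩)
    exact ⟨t, SegmentFamily.index_inj ((hf t).symm.trans hi)⟩
  have hcount : throughCount S c = J.card := by
    have : {j | c.GoesThrough S j} = Set.range f := by
      ext j
      exact ⟨hthrough j, fun ⟨t, ht⟩ => ⟨g t, ht ▸ hf t⟩⟩
    rw [throughCount, this, ← Set.image_univ, Set.ncard_image_of_injective _ hinj, Set.ncard_univ,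
      Nat.card_fin]
  have key : ∀ s j j', (∀ u, g j ≤ u → u ≤ g j' →
      Disjoint (segment ℝ (S.left s) (S.right s)) (c.edge u)) → j ≤ j' →
      (S.OnLeft (f j) s ↔ S.OnLeft (f j') s) := by
    intro s j j' h hjj
    have h1 : (g j : ℕ) ≤ g j' := g.monotone hjj
    have h2 := hgJ j
    have h3 := hgJ j'
    rw [Nat.even_iff] at h2 h3
    exact PolygonalChain.onLeft_iff_of_disjoint hS he (hf j) (((g j' : ℕ) - g j) / 2) (g j') (f j')
      (hf j') (by omega) h
  have key' : ∀ s (P : Fin J.card → Prop), (∀ j j', P j → P j' → j ≤ j' →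
      (S.OnLeft (f j) s ↔ S.OnLeft (f j') s)) → ∀ j j', P j → P j' →
      (S.OnLeft (f j) s ↔ S.OnLeft (f j') s) := by
    intro s P h j j' hj hj'
    rcases le_total j j' with hjj | hjj
    · exact h j j' hj hj' hjj
    · exact (h j' j hj' hj hjj).symm
  rw [hcount]
  refine ⟨f, hinj, ?_, ?_⟩
  · rintro i j j' (⟨hj, hj'⟩ | ⟨hj, hj'⟩)
    · refine key' (f i) (· < i) (fun j j' _ hj' => key _ _ _ fun u _ hu => ?_) j j' hj hj'
      rw [← (hf i).edge_eq]
      have h1 := hgap _ _ hj'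
      have hu : (u : ℕ) ≤ g j' := hu
      exact (hdis u (g i) (by omega)).symm
    · refine key' (f i) (i < ·) (fun j j' hj _ => key _ _ _ fun u hu _ => ?_) j j' hj hj'
      rw [← (hf i).edge_eq]
      have h1 := hgap _ _ hj
      have hu : (g j : ℕ) ≤ u := hu
      exact hdis (g i) u (by omega)
  · intro hcomp s hs j j'
    have hs' : ¬ c.GoesThrough S s := fun h => hs (hthrough s h)
    exact key' s (fun _ => True) (fun j j' _ _ => key _ _ _ fun u _ _ => (hcomp s hs' u).symm)
      j j' trivial trivial

/-! ### From an arrangement to an alternating path -/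

/-- The polygonal chain through the points of a nonempty list. -/
def PolygonalChain.ofList {ι : Type} (v : ι → Plane) (z : List ι) (hz : z ≠ []) :
    PolygonalChain where
  length := z.length - 1
  vertex i := v (z[(i : ℕ)]'(by have := List.length_pos_iff.2 hz; omega))

theorem PolygonalChain.vertex_ofList {ι : Type} (v : ι → Plane) {z : List ι} (hz : z ≠ [])
    (i : Fin ((ofList v z hz).length + 1)) {t : ℕ} (ht : t < z.length) (hi : (i : ℕ) = t) :
    (ofList v z hz).vertex i = v z[t] := by
  subst hi
  rfl

theorem Unobstructed.between_iff {ι : Type} {pos : ι → ℕ} {z : List ι} (hz : Unobstructed pos z)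
    {i j j' : ℕ} (hij : i + 1 < j) (hij' : i + 1 < j') (hj : j < z.length) (hj' : j' < z.length) :
    Between pos z[i] z[i + 1] z[j] ↔ Between pos z[i] z[i + 1] z[j'] := by
  induction z generalizing i j j' with
  | nil => simp at hj
  | cons x z ih =>
    cases z with
    | nil => simp at hj; omega
    | cons y l =>
      obtain ⟨j, rfl⟩ : ∃ t, j = t + 2 := ⟨j - 2, by omega⟩
      obtain ⟨j', rfl⟩ : ∃ t, j' = t + 2 := ⟨j' - 2, by omega⟩
      cases i with
      | zero => exact hz.1 _ (List.getElem_mem _) _ (List.getElem_mem _)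
      | succ i =>
        exact ih hz.2 (i := i) (j := j + 1) (j' := j' + 1) (by omega) (by omega)
          (by simpa using hj) (by simpa using hj')

theorem PolygonalChain.isSimple_ofList {ι : Type} {v : ι → Plane} {pos : ι → ℕ}
    (hp : IsCounterclockwise v pos) (hv : Function.Injective v) {z : List ι} (hz : z ≠ [])
    (hnd : z.Nodup) (hun : Unobstructed pos z) : (ofList v z hz).IsSimple := by
  have hlen := List.length_pos_iff.2 hz
  have hne : ∀ i j (hi : i < z.length) (hj : j < z.length), i ≠ j → z[i] ≠ z[j] :=
    fun i j hi hj hij h => hij ((hnd.getElem_inj_iff).1 h)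
  have hL : (ofList v z hz).length = z.length - 1 := rfl
  refine ⟨fun i => ?_, fun i j hij => ?_, fun i j hij => ?_⟩
  · have hi := i.2
    exact hv.ne (hne i (i + 1) (by omega) (by omega) (by omega))
  · have hj := j.2
    have h := hp.orient_ne_zero (hne i (i + 1) (by omega) (by omega) (by omega))
      (hne i (i + 2) (by omega) (by omega) (by omega))
      (hne (i + 1) (i + 2) (by omega) (by omega) (by omega))
    have e1 : (ofList v z hz).edge j =
        segment ℝ (v (z[(i : ℕ) + 1]'(by omega))) (v (z[(i : ℕ) + 2]'(by omega))) := by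
      rw [edge, vertex_ofList v hz j.castSucc (t := i + 1) (by omega) (by simpa using hij.symm),
        vertex_ofList v hz j.succ (t := i + 2) (by omega) (by simp; omega)]
    rw [e1]
    exact segment_inter_segment_of_orient h
  · have hj := j.2
    refine (hp.disjoint_iff (hne i (i + 1) (by omega) (by omega) (by omega))
      (hne i j (by omega) (by omega) (by omega))
      (hne (i + 1) j (by omega) (by omega) (by omega))
      (hne i (j + 1) (by omega) (by omega) (by omega))
      (hne (i + 1) (j + 1) (by omega) (by omega) (by omega))).2 ?_
    exact hun.between_iff hij (by omega) (by omega) (by omega)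

section Endpoints

variable {n : ℕ}

theorem length_endpoints (l : List (Fin n × Bool)) : (endpoints l).length = 2 * l.length := by
  induction l with
  | nil => rfl
  | cons p l ih =>
    simp only [endpoints, List.length_cons, ih]
    ring

theorem getElem_endpoints (l : List (Fin n × Bool)) (t : ℕ) (ht : t < l.length) :
    (endpoints l)[2 * t]'(by rw [length_endpoints]; omega) = endpoint l[t].1 l[t].2 ∧
    (endpoints l)[2 * t + 1]'(by rw [length_endpoints]; omega) = endpoint l[t].1 (!l[t].2) := by
  induction l generalizing t with
  | nil => simp at ht
  | cons p l ih =>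
    cases t with
    | zero => exact ⟨rfl, rfl⟩
    | succ t => exact ih t (by simpa using ht)

theorem endpoint_ne (i : Fin n) (b : Bool) : endpoint i b ≠ endpoint i !b := by
  cases b <;> simp [endpoint]

theorem nodup_endpoints {l : List (Fin n × Bool)} (hl : (l.map Prod.fst).Nodup) :
    (endpoints l).Nodup := by
  induction l with
  | nil => exact List.nodup_nil
  | cons p l ih =>
    rw [List.map_cons, List.nodup_cons] at hl
    have h : ∀ b, endpoint p.1 b ∉ endpoints l := fun b hb =>
      hl.1 (by simpa using segIndex_of_mem_endpoints hb)
    simp only [endpoints, List.nodup_cons, List.mem_cons, not_or]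
    exact ⟨⟨endpoint_ne _ _, h _⟩, h _, ih hl.2⟩

end Endpoints

theorem SegmentFamily.point_endpoint {n : ℕ} (S : SegmentFamily n) (i : Fin n) (b : Bool) :
    s(S.point (endpoint i b), S.point (endpoint i !b)) = s(S.left i, S.right i) := by
  cases b
  · exact Sym2.eq_swap
  · rfl

/-- The arrangement fits in a numbering in which its first segment contains the others. -/
theorem SegmentFamily.exists_numbering_nested {n : ℕ} {S : SegmentFamily n}
    (hS : S.InConvexPosition) {k : ℕ} {f : Fin (k + 1) → Fin n} (hf : Function.Injective f)
    (hn : NoSeparation S.OnLeft f) :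
    ∃ pos, IsCounterclockwise S.point pos ∧ ∀ j, j ≠ 0 → Nested pos (f j) (f 0) := by
  have hiff : ∀ {pos : Fin n ⊕ Fin n → ℕ}, IsCounterclockwise S.point pos → ∀ j, j ≠ 0 →
      (S.OnLeft (f j) (f 0) ↔
        (pos (.inl (f 0)) < pos (.inr (f 0)) ↔ ¬ Nested pos (f j) (f 0))) := by
    intro pos hp j hj
    rw [← (isNoncrossing hp).between_iff_nested (hf.ne hj.symm)]
    exact hp.orient_pos_iff Sum.inl_ne_inr (Sum.inl_injective.ne (hf.ne hj.symm)) Sum.inr_ne_inl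
  by_cases h : ∃ j, j ≠ 0 ∧ S.OnLeft (f j) (f 0)
  · obtain ⟨j₀, hj₀, h⟩ := h
    -- All later segments lie on the same side of `f 0`; the numbering starts at the end of `f 0`
    -- that puts this side inside the interval.
    obtain ⟨pos, hp, ho⟩ := exists_numbering hS (.inr (f 0))
    refine ⟨pos, hp, fun j hj => ?_⟩
    have h1 := (hn 0 j₀ j (.inr ⟨Fin.pos_of_ne_zero hj₀, Fin.pos_of_ne_zero hj⟩)).1 h
    have h2 := hiff hp j hj
    have h3 := ho (.inl (f 0))
    have : ¬ pos (.inl (f 0)) < pos (.inr (f 0)) := by omega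
    tauto
  · obtain ⟨pos, hp, ho⟩ := exists_numbering hS (.inl (f 0))
    refine ⟨pos, hp, fun j hj => ?_⟩
    have h1 : ¬ S.OnLeft (f j) (f 0) := fun h' => h ⟨j, hj, h'⟩
    have h2 := hiff hp j hj
    have h3 := ho (.inr (f 0))
    have h4 := (isNoncrossing hp).ne (f 0)
    have : pos (.inl (f 0)) < pos (.inr (f 0)) := by omega
    tauto

/-- The links of the path join ends of chosen segments, so an omitted segment that separates no
chosen ones meets no link. -/
theorem NoSeparation.exists_alternatingPath {n : ℕ} {S : SegmentFamily n}
    (hS : S.InConvexPosition) {k : ℕ} {f : Fin k → Fin n} (hf : Function.Injective f)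
    (hn : NoSeparation S.OnLeft f) :
    ∃ c, IsAlternatingPath S c ∧ throughCount S c = k ∧
      ((∀ e ∉ Set.range f, ∀ j j', S.OnLeft (f j) e ↔ S.OnLeft (f j') e) → IsCompatible S c) := by
  classical
  cases k with
  | zero =>
    refine ⟨⟨0, fun _ => 0⟩, ⟨⟨fun i => i.elim0, fun i => i.elim0, fun i => i.elim0⟩, 0,
      fun i => i.elim0⟩, ?_, fun _ j _ i => i.elim0⟩
    rw [throughCount, Set.ncard_eq_zero]
    exact Set.eq_empty_of_forall_notMem fun j ⟨i, _⟩ => i.elim0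
  | succ k =>
  obtain ⟨pos, hp, hnest⟩ := SegmentFamily.exists_numbering_nested hS hf hn
  have hnc := SegmentFamily.isNoncrossing hp
  have hR : ∀ i, i ∈ Finset.univ.image f ↔ i ∈ Set.range f := fun i => by simp
  let rank : Fin n → ℕ := Function.extend f Fin.val 0
  have hrank : ∀ i, rank (f i) = i := fun i => hf.extend_apply _ _ i
  have hN : ∀ i j j', (j < i ∧ j' < i) ∨ (i < j ∧ i < j') →
      (Nested pos (f j) (f i) ↔ Nested pos (f j') (f i)) := by
    intro i j j' h
    have h1 : j ≠ i ∧ j' ≠ i := by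
      rcases h with h | h
      · exact ⟨h.1.ne, h.2.ne⟩
      · exact ⟨h.1.ne', h.2.ne'⟩
    exact (SegmentFamily.onLeft_iff_iff hp (hf.ne h1.1) (hf.ne h1.2)).1 (hn i j j' h)
  obtain ⟨gs, hnd, hmem, hun, -⟩ := hnc.exists_unobstructed rank (Finset.univ.image f)
    ⟨f 0, by simp⟩
    (by
      simp only [hR]
      rintro _ ⟨i, rfl⟩ _ ⟨j, rfl⟩ h
      rw [hrank, hrank] at h
      rw [Fin.ext h])
    (by
      simp only [hR]
      rintro _ ⟨i, rfl⟩ _ ⟨j, rfl⟩ h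
      rw [hrank, hrank, ← Fin.lt_def] at h
      -- The segment `f j` treats the earlier segments `f i` and `f 0` alike, and it cannot contain
      -- `f 0`, which contains it.
      have hj : j ≠ 0 := (lt_of_le_of_lt (Fin.zero_le i) h).ne'
      rw [hN j i 0 (.inl ⟨h, Fin.pos_of_ne_zero hj⟩)]
      exact fun h' => lt_irrefl _ (h'.1.trans (hnest j hj).1))
    (by
      simp only [hR]
      rintro _ ⟨i, rfl⟩ _ ⟨j, rfl⟩ _ ⟨l, rfl⟩ h h'
      rw [hrank, hrank, ← Fin.lt_def] at h h'
      exact hN i j l (.inr ⟨h, h'⟩))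
  simp only [hR] at hmem
  have hlen : gs.length = k + 1 := by
    have h1 : (gs.map Prod.fst).toFinset = Finset.univ.image f := by
      ext i
      simp only [List.mem_toFinset, hmem, hR]
    have h2 := List.toFinset_card_of_nodup hnd
    rw [h1, Finset.card_image_of_injective _ hf, Finset.card_fin, List.length_map] at h2
    exact h2.symm
  have hzlen := length_endpoints gs
  have hz : endpoints gs ≠ [] := by
    rw [← List.length_pos_iff]
    omega
  let c := PolygonalChain.ofList S.point (endpoints gs) hz
  have hL : c.length = (endpoints gs).length - 1 := rfl
  have hpt : Function.Injective S.point := hS.injective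
  have heven : ∀ (i : Fin c.length) (t : ℕ) (ht : t < gs.length), (i : ℕ) = 2 * t →
      c.EdgeIs S i gs[t].1 := by
    intro i t ht hit
    have h := getElem_endpoints gs t ht
    unfold PolygonalChain.EdgeIs
    rw [← S.point_endpoint gs[t].1 gs[t].2, ← h.1, ← h.2,
      PolygonalChain.vertex_ofList S.point hz i.castSucc (t := 2 * t) (by omega) hit,
      PolygonalChain.vertex_ofList S.point hz i.succ (t := 2 * t + 1) (by omega) (by simp [hit])]
  have hodd : ∀ (i : Fin c.length) (t : ℕ), (i : ℕ) = 2 * t + 1 → ¬ ∃ j, c.EdgeIs S i j := by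
    rintro i t hit ⟨j, hj⟩
    have hi := i.2
    obtain ⟨x, y, hx, hy, hx', hy'⟩ := hj.exists_points
    have h1 := (getElem_endpoints gs t (by omega)).2
    have h2 := (getElem_endpoints gs (t + 1) (by omega)).1
    have hx'' : (endpoints gs)[2 * t + 1]'(by omega) = x := by
      apply hpt
      exact (PolygonalChain.vertex_ofList S.point hz i.castSucc (by omega) hit).symm.trans hx'
    have hy'' : (endpoints gs)[2 * (t + 1)]'(by omega) = y := by
      apply hpt
      exact (PolygonalChain.vertex_ofList S.point hz i.succ (by omega)
        (by simp [hit]; ring)).symm.trans hy'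
    rw [h1] at hx''
    rw [h2] at hy''
    have h3 : (gs.map Prod.fst)[t]'(by simp; omega) = (gs.map Prod.fst)[t + 1]'(by simp; omega) := by
      rw [List.getElem_map, List.getElem_map, ← segIndex_endpoint gs[t].1 (!gs[t].2), hx'', hx,
        ← hy, ← hy'', segIndex_endpoint]
    have := (hnd.getElem_inj_iff).1 h3
    omega
  have halt : ∀ i : Fin c.length, (∃ j, c.EdgeIs S i j) ↔ Even ((i : ℕ) + 0) := by
    intro i
    have hi := i.2
    rcases Nat.even_or_odd' (i : ℕ) with ⟨t, h | h⟩
    · exact iff_of_true ⟨_, heven i t (by omega) h⟩ ⟨t, by omega⟩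
    · refine iff_of_false (hodd i t h) ?_
      rw [Nat.even_iff]
      omega
  have hthrough : ∀ j, c.GoesThrough S j ↔ j ∈ Set.range f := by
    intro j
    rw [← hmem]
    constructor
    · rintro ⟨i, hi⟩
      obtain ⟨t, ht⟩ := (halt i).1 ⟨j, hi⟩
      have hi' := i.2
      have := heven i t (by omega) (by omega)
      rw [SegmentFamily.index_inj (hi.symm.trans this)]
      exact List.mem_map.2 ⟨_, List.getElem_mem _, rfl⟩
    · intro hj
      obtain ⟨t, ht, hjt⟩ := List.getElem_of_mem hj
      rw [List.length_map] at ht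
      rw [List.getElem_map] at hjt
      exact ⟨⟨2 * t, by omega⟩, hjt ▸ heven _ t ht rfl⟩
  refine ⟨c, ⟨PolygonalChain.isSimple_ofList hp hpt hz (nodup_endpoints hnd) hun, 0, halt⟩, ?_, ?_⟩
  · have : {j | c.GoesThrough S j} = Set.range f := Set.ext hthrough
    rw [throughCount, this, ← Set.image_univ, Set.ncard_image_of_injective _ hf, Set.ncard_univ,
      Nat.card_fin]
  · intro hout e he i
    rw [hthrough] at he
    have hseg : ∀ w ∈ endpoints gs, segIndex w ∈ Set.range f := fun w hw =>
      (hmem _).1 (segIndex_of_mem_endpoints hw)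
    have hi := i.2
    obtain ⟨j, hj⟩ := hseg ((endpoints gs)[(i : ℕ)]'(by omega)) (List.getElem_mem _)
    obtain ⟨j', hj'⟩ := hseg ((endpoints gs)[(i : ℕ) + 1]'(by omega)) (List.getElem_mem _)
    have hne : ∀ t, f t ≠ e := fun t h => he ⟨t, h⟩
    have hside := hout e he j j'
    rw [hj, hj'] at hside
    exact ((SegmentFamily.disjoint_iff_onLeft hS (x := (endpoints gs)[(i : ℕ)]'(by omega))
      (y := (endpoints gs)[(i : ℕ) + 1]'(by omega)) (by rw [← hj]; exact hne j)
      (by rw [← hj']; exact hne j')).2 hside).symm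

/-! ### Segments with a given forest order -/

/-- Every finite forest order is the nesting order of intervals with distinct ends. -/
theorem IsForestOrder.exists_intervals {E : Type} {B : E → E → Prop} (hB : IsForestOrder B)
    (R : Finset E) :
    ∃ l r : E → ℕ, (∀ i ∈ R, l i < r i) ∧ (∀ i ∈ R, ∀ j ∈ R, l i ≠ r j) ∧
      (∀ i ∈ R, ∀ j ∈ R, i ≠ j → l i ≠ l j ∧ r i ≠ r j) ∧
      ∀ i ∈ R, ∀ j ∈ R, i ≠ j → (B j i ↔ l i < l j ∧ r j < r i) ∧
        (r i < l j ∨ r j < l i ∨ B i j ∨ B j i) := by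
  classical
  induction hn : R.card generalizing R with
  | zero =>
    rw [Finset.card_eq_zero] at hn
    subst hn
    exact ⟨fun _ => 0, fun _ => 0, by simp, by simp, by simp, by simp⟩
  | succ n ih =>
    have hwf : ∃ x ∈ R, ∀ y ∈ R, ¬ B y x := by
      have hne : R.Nonempty := Finset.card_pos.1 (by omega)
      let B' : R → R → Prop := fun x y => B x y
      have hB' : IsForestOrder B' := ⟨fun i => hB.irrefl i, fun i j l => hB.trans i j l,
        fun i j l h h' => (hB.chain i j l h h').imp_left Subtype.ext⟩
      obtain ⟨x, -, hx⟩ := hB'.wellFounded.has_min Set.univ ⟨⟨_, hne.choose_spec⟩, trivial⟩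
      exact ⟨x, x.2, fun y hy => hx ⟨y, hy⟩ trivial⟩
    obtain ⟨x, hx, hmin⟩ := hwf
    obtain ⟨l, r, h1, h2, h3, h4⟩ := ih (R.erase x) (by rw [Finset.card_erase_of_mem hx]; omega)
    -- the position in which a tiny interval is inserted
    obtain ⟨q, hq, hq'⟩ : ∃ q : ℕ, (∀ i ∈ R.erase x, 3 * l i ≠ q + 1 ∧ 3 * l i ≠ q + 2 ∧
        3 * r i ≠ q + 1 ∧ 3 * r i ≠ q + 2) ∧
        ∀ i ∈ R.erase x, (B x i ↔ 3 * l i < q + 1 ∧ q + 2 < 3 * r i) ∧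
          (B x i ∨ 3 * r i < q + 1 ∨ q + 2 < 3 * l i) := by
      by_cases hp : ∃ p ∈ R, B x p
      · obtain ⟨p, hpR, hxp, hpmin⟩ : ∃ p ∈ R, B x p ∧ ∀ i ∈ R, B x i → ¬ B i p := by
          let B' : R → R → Prop := fun x y => B x y
          have hB' : IsForestOrder B' := ⟨fun i => hB.irrefl i, fun i j l => hB.trans i j l,
            fun i j l h h' => (hB.chain i j l h h').imp_left Subtype.ext⟩
          obtain ⟨p, hp, hp'⟩ := hp
          obtain ⟨p, hp, hpmin⟩ := hB'.wellFounded.has_min {p | B x p} ⟨⟨p, hp⟩, hp'⟩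
          exact ⟨p, p.2, hp, fun i hi hxi => hpmin ⟨i, hi⟩ hxi⟩
        have hpx : p ≠ x := by rintro rfl; exact hB.irrefl _ hxp
        have hpR' : p ∈ R.erase x := Finset.mem_erase.2 ⟨hpx, hpR⟩
        have hlr := h1 p hpR'
        -- The interval is inserted right after the left end of `p`, the least element above `x`.
        refine ⟨3 * l p, fun i hi => by omega, fun i hi => ?_⟩
        have hiR := Finset.mem_of_mem_erase hi
        rcases eq_or_ne i p with rfl | hip
        · exact ⟨iff_of_true hxp ⟨by omega, by omega⟩, .inl hxp⟩
        have h5 := h4 i hi p hpR' hip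
        have h6 := h4 p hpR' i hi hip.symm
        have h7 := h1 i hi
        have h8 : B x i ↔ B p i := by
          refine ⟨fun h => ?_, fun h => hB.trans _ _ _ hxp h⟩
          rcases hB.chain x i p h hxp with h' | h' | h'
          · exact absurd h' hip
          · exact absurd h' (hpmin i hiR h)
          · exact h'
        have h9 := h3 i hi p hpR' hip
        have h10 := h2 p hpR' i hi
        rw [h8]
        grind
      · push Not at hp
        obtain ⟨M, hM⟩ : ∃ M, ∀ i ∈ R.erase x, r i < M :=
          ⟨(R.erase x).sup r + 1, fun i hi => Nat.lt_succ_of_le (Finset.le_sup hi)⟩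
        refine ⟨3 * M, fun i hi => by omega, fun i hi => ?_⟩
        have h5 := hM i hi
        have h6 := hp i (Finset.mem_of_mem_erase hi)
        exact ⟨iff_of_false h6 (by omega), .inr (.inl (by omega))⟩
    -- Scaling by `3` leaves two free numbers after each old end, room for the minimal element `x`.
    let l' : E → ℕ := fun i => if i = x then q + 1 else 3 * l i
    let r' : E → ℕ := fun i => if i = x then q + 2 else 3 * r i
    have hl' : ∀ i, i ≠ x → l' i = 3 * l i := fun i hi => if_neg hi
    have hr' : ∀ i, i ≠ x → r' i = 3 * r i := fun i hi => if_neg hi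
    have hlx : l' x = q + 1 := if_pos rfl
    have hrx : r' x = q + 2 := if_pos rfl
    refine ⟨l', r', fun i hi => ?_, fun i hi j hj => ?_, fun i hi j hj hij => ?_,
      fun i hi j hj hij => ?_⟩
    · by_cases hix : i = x
      · subst hix; omega
      · rw [hl' i hix, hr' i hix]
        have := h1 i (Finset.mem_erase.2 ⟨hix, hi⟩)
        omega
    · by_cases hix : i = x <;> by_cases hjx : j = x
      · subst hix; subst hjx; omega
      · subst hix
        have := hq j (Finset.mem_erase.2 ⟨hjx, hj⟩)
        rw [hlx, hr' j hjx]; omega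
      · subst hjx
        have := hq i (Finset.mem_erase.2 ⟨hix, hi⟩)
        rw [hrx, hl' i hix]; omega
      · have := h2 i (Finset.mem_erase.2 ⟨hix, hi⟩) j (Finset.mem_erase.2 ⟨hjx, hj⟩)
        rw [hl' i hix, hr' j hjx]; omega
    · by_cases hix : i = x <;> by_cases hjx : j = x
      · exact absurd (hix.trans hjx.symm) hij
      · subst hix
        have := hq j (Finset.mem_erase.2 ⟨hjx, hj⟩)
        rw [hlx, hrx, hr' j hjx, hl' j hjx]; omega
      · subst hjx
        have := hq i (Finset.mem_erase.2 ⟨hix, hi⟩)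
        rw [hlx, hrx, hr' i hix, hl' i hix]; omega
      · have := h3 i (Finset.mem_erase.2 ⟨hix, hi⟩) j (Finset.mem_erase.2 ⟨hjx, hj⟩) hij
        rw [hl' i hix, hr' j hjx, hl' j hjx, hr' i hix]; omega
    · by_cases hix : i = x <;> by_cases hjx : j = x
      · exact absurd (hix.trans hjx.symm) hij
      · subst hix
        have h5 := hq' j (Finset.mem_erase.2 ⟨hjx, hj⟩)
        have h6 := h1 j (Finset.mem_erase.2 ⟨hjx, hj⟩)
        have h7 := hmin j hj
        rw [hlx, hrx, hr' j hjx, hl' j hjx]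
        refine ⟨iff_of_false h7 (by omega), ?_⟩
        grind
      · subst hjx
        have h5 := hq' i (Finset.mem_erase.2 ⟨hix, hi⟩)
        rw [hlx, hrx, hr' i hix, hl' i hix]
        refine ⟨h5.1, ?_⟩
        grind
      · have h5 := h4 i (Finset.mem_erase.2 ⟨hix, hi⟩) j (Finset.mem_erase.2 ⟨hjx, hj⟩) hij
        rw [hl' i hix, hr' j hjx, hl' j hjx, hr' i hix]
        grind

/-- A point of the standard parabola. -/
noncomputable def parabola (t : ℝ) : Plane := !₂[t, t ^ 2]

theorem orient_parabola (a b c : ℝ) :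
    orient (parabola a) (parabola b) (parabola c) = (b - a) * (c - a) * (c - b) := by
  simp [orient, parabola]
  ring

theorem convexIndependent_parabola {ι : Type} {t : ι → ℝ} (ht : Function.Injective t) :
    ConvexIndependent ℝ fun i => parabola (t i) := by
  intro s x hx
  by_contra hxs
  -- `g` vanishes on the tangent at `parabola (t x)`, and all other points of the parabola are on
  -- its positive side.
  let g : Plane → ℝ := fun P => P 1 - 2 * t x * P 0 + t x ^ 2
  have hconv : Convex ℝ {P : Plane | 0 < g P} := by
    intro P hP Q hQ a b ha hb hab
    have hP : 0 < g P := hP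
    have hQ : 0 < g Q := hQ
    have h : g (a • P + b • Q) = a * g P + b * g Q := by
      obtain rfl : a = 1 - b := by linarith
      simp [g]
      ring
    change 0 < g (a • P + b • Q)
    rw [h]
    rcases ha.eq_or_lt with rfl | ha
    · obtain rfl : b = 1 := by linarith
      linarith
    · have := mul_pos ha hP
      have := mul_nonneg hb hQ.le
      linarith
  have hsub : (fun i => parabola (t i)) '' s ⊆ {P : Plane | 0 < g P} := by
    rintro _ ⟨i, hi, rfl⟩
    have hne : t i - t x ≠ 0 := sub_ne_zero.2 (ht.ne fun h => hxs (h ▸ hi))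
    have h : g (parabola (t i)) = (t i - t x) ^ 2 := by
      simp [g, parabola]
      ring
    change 0 < g (parabola (t i))
    rw [h]
    positivity
  have h0 : 0 < g (parabola (t x)) := convexHull_min hsub hconv hx
  have h : g (parabola (t x)) = 0 := by
    simp [g, parabola]
    ring
  linarith

/-- The ends of nested or separate intervals, placed on a parabola, give disjoint chords; the points
to the left of a chord are those whose parameter is outside its interval. -/
theorem IsForestOrder.exists_segmentFamily {m : ℕ} {B : Fin m → Fin m → Prop}
    (hB : IsForestOrder B) :
    ∃ S : SegmentFamily m, S.InConvexPosition ∧ ∀ i j, j ≠ i → (S.OnLeft j i ↔ ¬ B j i) := by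
  obtain ⟨l, r, h1, h2, h3, h4⟩ := hB.exists_intervals Finset.univ
  simp only [Finset.mem_univ, true_implies] at h1 h2 h3 h4
  let t : Fin m ⊕ Fin m → ℝ := Sum.elim (fun i => (l i : ℝ)) fun i => (r i : ℝ)
  have ht : Function.Injective t := by
    rintro (i | i) (j | j) h
    · by_contra hne
      exact (h3 i j fun h => hne (congrArg _ h)).1 (Nat.cast_injective h)
    · exact absurd (Nat.cast_injective h) (h2 i j)
    · exact absurd (Nat.cast_injective h).symm (h2 j i)
    · by_contra hne
      exact (h3 i j fun h => hne (congrArg _ h)).2 (Nat.cast_injective h)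
  have hconv := convexIndependent_parabola ht
  have hpt := hconv.injective
  have hsign : ∀ i (x : ℕ), x ≠ l i → x ≠ r i →
      orient (parabola (l i)) (parabola (r i)) (parabola x) ≠ 0 ∧
      (0 < orient (parabola (l i)) (parabola (r i)) (parabola x) ↔ ¬ (l i < x ∧ x < r i)) := by
    intro i x hx hx'
    have h5 : (0 : ℝ) < r i - l i := sub_pos.2 (Nat.cast_lt.2 (h1 i))
    have h6 : (x : ℝ) - l i ≠ 0 := sub_ne_zero.2 (Nat.cast_injective.ne hx)
    have h7 : (x : ℝ) - r i ≠ 0 := sub_ne_zero.2 (Nat.cast_injective.ne hx')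
    rw [orient_parabola, mul_assoc]
    refine ⟨mul_ne_zero h5.ne' (mul_ne_zero h6 h7), ?_⟩
    rw [mul_pos_iff_of_pos_left h5, mul_pos_iff, sub_pos, sub_pos, sub_neg, sub_neg,
      Nat.cast_lt, Nat.cast_lt, Nat.cast_lt, Nat.cast_lt]
    have := h1 i
    omega
  let S : SegmentFamily m :=
    { left i := parabola (l i)
      right i := parabola (r i)
      left_ne_right i h := Sum.inl_ne_inr (hpt (a₁ := .inl i) (a₂ := .inr i) h)
      disjoint i j hij := by
        have h5 := h3 i j hij
        have h6 := h2 i j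
        have h7 := h2 j i
        have h8 := hsign i (l j) h5.1.symm h7
        have h9 := hsign i (r j) h6.symm h5.2.symm
        refine disjoint_segment_of_orient h8.1 h9.1 ?_
        rw [h8.2, h9.2]
        have h10 := h4 i j hij
        have h11 := h4 j i hij.symm
        have := h1 i
        have := h1 j
        grind }
  refine ⟨S, ?_, fun i j hij => ?_⟩
  · have : (Sum.elim S.left S.right : Fin m ⊕ Fin m → Plane) = fun i => parabola (t i) := by
      funext i
      cases i <;> rfl
    rw [SegmentFamily.InConvexPosition, this]
    exact hconv
  · have h5 := h4 i j hij.symm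
    have h6 := h4 j i hij
    have h7 := h3 i j hij.symm
    refine (hsign i (l j) h7.1.symm (h2 j i)).2.trans (not_congr ?_)
    have := h1 i
    have := h1 j
    have := h2 i j
    have := h2 j i
    grind

/-! ### Equality of the sets of sizes -/

theorem mem_pathSizes_iff {m k : ℕ} : k ∈ pathSizes m ↔
    ∀ S : SegmentFamily m, S.InConvexPosition → Arrangeable S.OnLeft k := by
  refine forall_congr' fun S => imp_congr_right fun hS => ⟨?_, ?_⟩
  · rintro ⟨c, hc, rfl⟩
    obtain ⟨f, hf, hn, -⟩ := hc.exists_arrangement hS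
    exact ⟨f, hf, hn⟩
  · rintro ⟨f, hf, hn⟩
    obtain ⟨c, hc, hk, -⟩ := hn.exists_alternatingPath hS hf
    exact ⟨c, hc, hk⟩

theorem mem_compatiblePathSizes_iff {m k : ℕ} : k ∈ compatiblePathSizes m ↔
    ∀ S : SegmentFamily m, S.InConvexPosition → ConnectedArrangeable S.OnLeft k := by
  refine forall_congr' fun S => imp_congr_right fun hS => ⟨?_, ?_⟩
  · rintro ⟨c, hc, hcomp, rfl⟩
    obtain ⟨f, hf, hn, ho⟩ := hc.exists_arrangement hS
    exact ⟨f, hf, hn, ho hcomp⟩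
  · rintro ⟨f, hf, hn, ho⟩
    obtain ⟨c, hc, hk, hcomp⟩ := hn.exists_alternatingPath hS hf
    exact ⟨c, hc, hcomp ho, hk⟩

theorem onLeft_congr {m : ℕ} {B : Fin m → Fin m → Prop} {S : SegmentFamily m}
    (h : ∀ i j, j ≠ i → (S.OnLeft j i ↔ ¬ B j i)) (e f g : Fin m) (hf : f ≠ e) (hg : g ≠ e)
    (hfg : S.OnLeft f e ↔ S.OnLeft g e) : B f e ↔ B g e := by
  rw [h e f hf, h e g hg] at hfg
  exact not_iff_not.1 hfg

/-- A property of relations that is invariant under complementing sides holds for all families of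
segments if and only if it holds for all finite forest orders. -/
theorem forall_onLeft_iff {m : ℕ} (P : (Fin m → Fin m → Prop) → Prop)
    (hP : ∀ B B' : Fin m → Fin m → Prop, (∀ e f g, f ≠ e → g ≠ e →
      (B f e ↔ B g e) → (B' f e ↔ B' g e)) → P B → P B') :
    (∀ S : SegmentFamily m, S.InConvexPosition → P S.OnLeft) ↔
      ∀ B : Fin m → Fin m → Prop, IsForestOrder B → P B := by
  constructor
  · intro h B hB
    obtain ⟨S, hS, hSB⟩ := hB.exists_segmentFamily
    exact hP _ _ (onLeft_congr hSB) (h S hS)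
  · intro h S hS
    obtain rfl | hm := Nat.eq_zero_or_pos m
    · exact hP _ _ (fun e => e.elim0) (h (fun _ _ => False)
        ⟨fun i => i.elim0, fun i => i.elim0, fun i => i.elim0⟩)
    obtain ⟨pos, hp, -⟩ := SegmentFamily.exists_numbering hS (.inl ⟨0, hm⟩)
    exact hP _ _ (fun e f g hf hg => (SegmentFamily.onLeft_iff_iff hp hf hg).2)
      (h _ (SegmentFamily.isNoncrossing hp).isForestOrder)

/-- The same for all trees with `m` edges. -/
theorem forall_tree_iff {m : ℕ} (P : (Fin m → Fin m → Prop) → Prop)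
    (hP : ∀ B B' : Fin m → Fin m → Prop, (∀ e f g, f ≠ e → g ≠ e →
      (B f e ↔ B g e) → (B' f e ↔ B' g e)) → P B → P B')
    (Q : ∀ (V : Type), SimpleGraph V → Prop)
    (hQ : ∀ (V : Type) [Finite V] (T : SimpleGraph V) (a b : Fin m → V) (D : Fin m → V → Prop),
      IsCutSystem T a b D → T.Connected → (Q V T ↔ P fun j i => D i (a j))) :
    (∀ (V : Type) [Finite V] (T : SimpleGraph V), T.IsTree → T.edgeSet.ncard = m → Q V T) ↔
      ∀ B : Fin m → Fin m → Prop, IsForestOrder B → P B := by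
  constructor
  · intro h B hB
    obtain ⟨T, a, b, D, hc, hT, hD⟩ := hB.exists_tree
    have h1 := h (Option (Fin m)) T (hc.isTree hT) (by rw [hc.ncard_edgeSet, Nat.card_fin])
    rw [hQ _ T a b D hc hT] at h1
    refine hP _ _ (fun e f g hf hg => ?_) h1
    rw [hD, hD]
    simp [hf, hg]
  · intro h V _ T hT hm
    obtain ⟨r⟩ := hT.connected.nonempty
    obtain ⟨a, b, D, hc, hr⟩ := exists_isCutSystem hT hm r
    rw [hQ V T a b D hc hT.connected]
    refine hP _ _ (fun e f g hf hg => ?_) (h _ (hc.isForestOrder hT.connected hr))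
    simp [hf, hg]

theorem pathSizes_eq_contractionSizes (m : ℕ) : pathSizes m = contractionSizes m := by
  ext k
  rw [mem_pathSizes_iff,
    forall_onLeft_iff (fun B => Arrangeable B k) fun _ _ h hB => hB.congr h]
  exact (forall_tree_iff (fun B => Arrangeable B k) (fun _ _ h hB => hB.congr h)
    (fun V T => ∃ F ⊆ T.edgeSet, IsCaterpillar (contractEdges T F) ∧
      (contractEdges T F).edgeSet.ncard = k)
    fun V _ T a b D hc hT => hc.exists_contractEdges_iff hT k).symm

theorem compatiblePathSizes_eq_removalSizes (m : ℕ) :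
    compatiblePathSizes m = removalSizes m := by
  ext k
  rw [mem_compatiblePathSizes_iff,
    forall_onLeft_iff (fun B => ConnectedArrangeable B k) fun _ _ h hB => hB.congr h]
  exact (forall_tree_iff (fun B => ConnectedArrangeable B k) (fun _ _ h hB => hB.congr h)
    (fun V T => ∃ A : Set V, IsCaterpillar (T.induce A) ∧ (T.induce A).edgeSet.ncard = k)
    fun V _ T a b D hc hT => hc.exists_induce_iff hT k).symm

/-! ### Existence of the maxima -/

theorem zero_mem_compatiblePathSizes (m : ℕ) : 0 ∈ compatiblePathSizes m :=
  mem_compatiblePathSizes_iff.2 fun _ _ =>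
    ⟨Fin.elim0, fun i => i.elim0, fun i => i.elim0, fun _ _ j => j.elim0⟩

theorem compatiblePathSizes_subset (m : ℕ) : compatiblePathSizes m ⊆ pathSizes m :=
  fun _ hk S hS => let ⟨c, hc, _, h⟩ := hk S hS; ⟨c, hc, h⟩

/-- Some family must exist for the bound to hold; the empty order, in which no segment lies inside
another, provides one. -/
theorem bddAbove_pathSizes (m : ℕ) : BddAbove (pathSizes m) := by
  refine ⟨m, fun k hk => ?_⟩
  obtain ⟨S, hS, -⟩ := IsForestOrder.exists_segmentFamily (m := m) (B := fun _ _ => False)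
    ⟨fun _ h => h, fun _ _ _ h => h.elim, fun _ _ _ h => h.elim⟩
  obtain ⟨f, hf, -⟩ := mem_pathSizes_iff.1 hk S hS
  simpa using Fintype.card_le_of_injective f hf

theorem isGreatest_p (m : ℕ) : IsGreatest (pathSizes m) (p m) :=
  ⟨Nat.sSup_mem ⟨0, compatiblePathSizes_subset m (zero_mem_compatiblePathSizes m)⟩
    (bddAbove_pathSizes m), fun _ hk => le_csSup (bddAbove_pathSizes m) hk⟩

theorem isGreatest_q (m : ℕ) : IsGreatest (compatiblePathSizes m) (q m) :=
  have hb := (bddAbove_pathSizes m).mono (compatiblePathSizes_subset m)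
  ⟨Nat.sSup_mem ⟨0, zero_mem_compatiblePathSizes m⟩ hb, fun _ hk => le_csSup hb hk⟩

end AltPath

theorem proposition3 (m : ℕ) (hm : 1 ≤ m) :
    (IsGreatest (AltPath.pathSizes m) (AltPath.p m) ∧
      IsGreatest (AltPath.contractionSizes m) (AltPath.p m)) ∧
    (IsGreatest (AltPath.compatiblePathSizes m) (AltPath.q m) ∧
      IsGreatest (AltPath.removalSizes m) (AltPath.q m)) := by
  rw [← AltPath.pathSizes_eq_contractionSizes, ← AltPath.compatiblePathSizes_eq_removalSizes]
  exact ⟨⟨AltPath.isGreatest_p m, AltPath.isGreatest_p m⟩,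
    AltPath.isGreatest_q m, AltPath.isGreatest_q m⟩
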